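/- Quantum systems are described by nonzero complex Hilbert spaces of arbitrary (possibly infinite) dimension, composite systems by (completed) tensor products, and a CPTP map from $A$ to $B$ is a linear, completely positive, trace-preserving map from the trace-class operators on $A$ to those on $B$ (so it maps the set $\mathcal{S}(A)$ of density operators to $\mathcal{S}(B)$). For a CPTP map $\mathcal{F}: SR\to S'R'$ we say that $S$ does not signal to $R'$ if $$\mathrm{tr}_{S'}\circ\mathcal{F}=\mathrm{tr}_{S'}\circ\mathcal{F}\circ(\mathcal{M}_S\otimes\mathcal{I}_R)$$ for every CPTP map $\mathcal{M}_S: S\to S$. Let $n\ge 1$ and let $\mathcal{E}: E_0S_1S_2\dots S_n\to S_1'S_2'\dots S_n'E_n$ be a CPTP map such that, for every $i\in\{2,\dots,n\}$, $S_i$ does not signal to $S_1'S_2'\dots S_{i-1}'$ in $\mathcal{E}$. Then there exist systems $E_1,\dots,E_{n-1}$ and CPTP maps $\mathcal{E}_j: E_{j-1}S_j\to S_j'E_j$, $j=1,\dots,n$, such that $$\mathcal{E}=\big(\mathcal{I}_{S_1'\dots S_{n-1}'}\otimes\mathcal{E}_n\big)\circ\dots\circ\big(\mathcal{I}_{S_1'}\otimes\mathcal{E}_2\otimes\mathcal{I}_{S_3\dots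 S_n}\big)\circ\big(\mathcal{E}_1\otimes\mathcal{I}_{S_2\dots S_n}\big).$$ -/

import Mathlib

universe u v
open scoped ComplexOrder
noncomputable section

namespace Quantum

/-- A quantum system is given by a type `I` labelling an orthonormal basis of its Hilbert space, which
is then `ℓ²(I)`. Every complex Hilbert space, of arbitrary (also non-separable) dimension, is of this
form up to a unitary. The composite of the systems `I` and `J` is `I × J`, since
`ℓ²(I) ⊗ ℓ²(J) = ℓ²(I × J)`; likewise the composite of a finite family is the product of the family. -/
abbrev Ell2 (I : Type u) : Type u := lp (fun _ : I => ℂ) 2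

open Classical in
/-- The standard basis vector `|i⟩`. -/
def ket {I : Type u} (i : I) : Ell2 I := lp.single 2 i (1 : ℂ)

/-- `X` is the matrix `⟨i|T|j⟩` of a positive bounded operator `T` of finite trace on `ℓ²(I)`. (An
operator is determined by its matrix. Density operators are the case of trace one.) -/
def IsPosTraceClass {I : Type u} (X : Matrix I I ℂ) : Prop :=
  (∃ T : Ell2 I →L[ℂ] Ell2 I, T.IsPositive ∧ ∀ i j, X i j = inner ℂ (ket i) (T (ket j))) ∧
    Summable fun i => X i i

theorem IsPosTraceClass.of_gram {I : Type u} {H : Type*} [NormedAddCommGroup H]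
    [InnerProductSpace ℂ H] [CompleteSpace H] {X : Matrix I I ℂ} (g : I → H)
    (hX : ∀ i j, X i j = inner ℂ (g i) (g j)) (hs : Summable fun i => X i i) :
    IsPosTraceClass X := by
  classical
  have hg : Summable fun i => ‖g i‖ ^ 2 := by
    have h1 := (Complex.hasSum_re hs.hasSum).summable
    refine h1.congr fun i => ?_
    rw [hX, inner_self_eq_norm_sq_to_K]; norm_cast
  have hx : ∀ x : Ell2 I, Summable fun i => ‖x i‖ ^ 2 := fun x => by
    simpa using (lp.memℓp x).summable (p := 2) (by norm_num)
  have key : ∀ x : Ell2 I, Summable (fun i => ‖x i‖ * ‖g i‖) ∧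
      ∑' i, ‖x i‖ * ‖g i‖ ≤ Real.sqrt (∑' i, ‖g i‖ ^ 2) * ‖x‖ := fun x => by
    have := Real.summable_and_inner_le_Lp_mul_Lq_tsum_of_nonneg (p := 2) (q := 2)
      (f := fun i => ‖x i‖) (g := fun i => ‖g i‖) ⟨by norm_num, by norm_num, by norm_num⟩ (fun i => norm_nonneg _)
      (fun i => norm_nonneg _) (by simpa using hx x) (by simpa using hg)
    refine ⟨this.1, this.2.trans (le_of_eq ?_)⟩
    rw [mul_comm, lp.norm_eq_tsum_rpow (p := 2) (by norm_num), Real.sqrt_eq_rpow]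
    simp
  have hsum : ∀ x : Ell2 I, Summable fun i => x i • g i := fun x =>
    Summable.of_norm (by simpa [norm_smul] using (key x).1)
  let A : Ell2 I →L[ℂ] H := LinearMap.mkContinuous
    { toFun := fun x => ∑' i, x i • g i
      map_add' := fun x y => by
        rw [← (hsum x).tsum_add (hsum y)]
        exact tsum_congr fun i => by simp [add_smul]
      map_smul' := fun c x => by
        rw [RingHom.id_apply, ← (hsum x).tsum_const_smul]
        exact tsum_congr fun i => by simp [mul_smul] }
    (Real.sqrt (∑' i, ‖g i‖ ^ 2)) (fun x => by
      refine (norm_tsum_le_tsum_norm (by simpa [norm_smul] using (key x).1)).trans ?_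
      simpa [norm_smul] using (key x).2)
  have hA : ∀ i, A (ket i) = g i := fun i => by
    change ∑' j, (ket i : Ell2 I) j • g j = g i
    rw [tsum_eq_single i]
    · simp [ket]
    · intro j hj; simp [ket, hj]
  refine ⟨⟨A.adjoint ∘L A, ContinuousLinearMap.isPositive_adjoint_comp_self A, fun i j => ?_⟩, hs⟩
  rw [ContinuousLinearMap.comp_apply, ContinuousLinearMap.adjoint_inner_right, hA, hA, hX]

theorem exists_gram {I : Type u} {X : Matrix I I ℂ} (h : X.PosSemidef) :
    ∃ (H : Type u) (_ : NormedAddCommGroup H) (_ : InnerProductSpace ℂ H) (_ : CompleteSpace H)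
      (g : I → H), ∀ i j, X i j = inner ℂ (g i) (g j) := by
  let K : Matrix I I (ℂ →L[ℂ] ℂ) := .of fun i j => X i j • ContinuousLinearMap.id ℂ ℂ
  have hh : K.IsHermitian := by
    ext i j
    refine ext_inner_right ℂ fun w => ?_
    have := h.1.apply i j
    rw [Matrix.conjTranspose_apply, ContinuousLinearMap.star_eq_adjoint,
      ContinuousLinearMap.adjoint_inner_left]
    simp [K, ← this, mul_comm]
  have hK : K.PosSemidef := by
    refine ((RKHS.posSemidef_tfae (K := K)).out 0 2).mpr (And.intro hh fun vv => ?_)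
    have := (Complex.le_def.1 (h.2 vv)).1
    refine this.trans (le_of_eq ?_)
    simp only [Finsupp.sum, RCLike.re_eq_complex_re]
    refine congrArg _ (Finset.sum_congr rfl fun i _ => Finset.sum_congr rfl fun j _ => ?_)
    have := h.1.apply i j
    rw [RCLike.star_def] at this
    simp [K, ← this]
    ring
  have : Fact K.PosSemidef := ⟨hK⟩
  refine ⟨RKHS.OfKernel K, inferInstance, inferInstance, inferInstance,
    fun i => RKHS.kerFun (RKHS.OfKernel K) i 1, fun i j => ?_⟩
  rw [RKHS.kerFun_inner, RKHS.kerFun_apply, RKHS.OfKernel.kernel_ofKernel]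
  simp [K]

theorem IsPosTraceClass.posSemidef {I : Type u} {X : Matrix I I ℂ} (h : IsPosTraceClass X) :
    X.PosSemidef := by
  obtain ⟨⟨T, hT, hX⟩, -⟩ := h
  refine ⟨?_, fun x => ?_⟩
  · ext i j
    rw [Matrix.conjTranspose_apply, hX, hX, RCLike.star_def, inner_conj_symm]
    exact hT.isSymmetric _ _
  · refine (hT.inner_nonneg_right (x.sum fun i c => c • ket i)).trans (le_of_eq ?_)
    simp only [Finsupp.sum, sum_inner, inner_sum, map_sum, map_smul, inner_smul_left,
      inner_smul_right, hX, Finset.mul_sum]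
    rw [Finset.sum_comm]
    refine Finset.sum_congr rfl fun i _ => Finset.sum_congr rfl fun j _ => ?_
    simp; ring

/-- The matrices of positive trace-class operators are the (possibly infinite) positive semidefinite
matrices with summable diagonal. -/
theorem isPosTraceClass_iff {I : Type u} {X : Matrix I I ℂ} :
    IsPosTraceClass X ↔ X.PosSemidef ∧ Summable fun i => X i i := by
  refine ⟨fun h => ⟨h.posSemidef, h.2⟩, fun ⟨h, hs⟩ => ?_⟩
  obtain ⟨H, _, _, _, g, hg⟩ := exists_gram h
  exact .of_gram g hg hs

/-- The trace-class operators on `ℓ²(I)`, through their matrices: the complex linear combinations of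
the positive ones, equivalently, of density operators. -/
def TraceClass (I : Type u) : Submodule ℂ (Matrix I I ℂ) :=
  Submodule.span ℂ {X | IsPosTraceClass X}

theorem summable_norm_sq_of_gram {I : Type u} {H : Type*} [NormedAddCommGroup H]
    [InnerProductSpace ℂ H] {X : Matrix I I ℂ} {g : I → H}
    (hX : ∀ i j, X i j = inner ℂ (g i) (g j)) (hs : Summable fun i => X i i) :
    Summable fun i => ‖g i‖ ^ 2 := by
  refine ((Complex.hasSum_re hs.hasSum).summable).congr fun i => ?_
  rw [hX, inner_self_eq_norm_sq_to_K]; norm_cast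

theorem isPosTraceClass_of_norm_sq {I : Type u} {H : Type*} [NormedAddCommGroup H]
    [InnerProductSpace ℂ H] [CompleteSpace H] (g : I → H) (hg : Summable fun i => ‖g i‖ ^ 2) :
    IsPosTraceClass (Matrix.of fun i j => inner ℂ (g i) (g j)) := by
  refine .of_gram g (fun _ _ => rfl) ?_
  refine (Complex.hasSum_ofReal.2 hg.hasSum).summable.congr fun i => ?_
  rw [Matrix.of_apply, inner_self_eq_norm_sq_to_K]; norm_cast

theorem mem_traceClass_of_inner {I : Type u} {H : Type*} [NormedAddCommGroup H]
    [InnerProductSpace ℂ H] [CompleteSpace H] {X : Matrix I I ℂ} (f g : I → H)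
    (hX : ∀ i j, X i j = inner ℂ (f i) (g j))
    (hf : Summable fun i => ‖f i‖ ^ 2) (hg : Summable fun i => ‖g i‖ ^ 2) :
    X ∈ TraceClass I := by
  have key : ∀ c : ℂ, ‖c‖ = 1 →
      (Matrix.of fun i j => inner ℂ (f i + c • g i) (f j + c • g j)) ∈ TraceClass I := by
    intro c hc
    refine Submodule.subset_span (isPosTraceClass_of_norm_sq (fun i => f i + c • g i) ?_)
    refine Summable.of_nonneg_of_le (fun _ => sq_nonneg _) (fun i => ?_)
      ((hf.add hg).mul_left 2)
    have h1 := norm_add_le (f i) (c • g i)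
    rw [norm_smul, hc, one_mul] at h1
    nlinarith [sq_nonneg (‖f i‖ - ‖g i‖), norm_nonneg (f i + c • g i)]
  have := (TraceClass I).smul_mem (1 / 4 : ℂ)
    ((TraceClass I).add_mem
      ((TraceClass I).sub_mem (key 1 (by simp)) (key (-1) (by simp)))
      ((TraceClass I).smul_mem (-Complex.I)
        ((TraceClass I).sub_mem (key Complex.I (by simp)) (key (-Complex.I) (by simp)))))
  convert this using 1
  ext i j
  simp only [hX, Matrix.smul_apply, Matrix.add_apply, Matrix.sub_apply, Matrix.of_apply,
    inner_add_left, inner_add_right, inner_smul_left, inner_smul_right, smul_eq_mul, map_neg,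
    map_one, Complex.conj_I]
  ring_nf
  simp only [Complex.I_sq]
  ring_nf

theorem summable_diag {I : Type u} {X : Matrix I I ℂ} (h : X ∈ TraceClass I) :
    Summable fun i => X i i := by
  induction h using Submodule.span_induction with
  | mem X hX => exact hX.2
  | zero => simp
  | add X Y _ _ hX hY => exact hX.add hY
  | smul c X _ hX => exact hX.const_smul c

/-- The trace. -/
def trace {I : Type u} : TraceClass I →ₗ[ℂ] ℂ where
  toFun X := ∑' i, X.1 i i
  map_add' X Y := (summable_diag X.2).tsum_add (summable_diag Y.2)
  map_smul' c X := (summable_diag X.2).tsum_const_smul c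

theorem linearMap_mem {I J : Type u} (L : Matrix I I ℂ →ₗ[ℂ] Matrix J J ℂ)
    (hL : ∀ X, IsPosTraceClass X → L X ∈ TraceClass J) {X : Matrix I I ℂ}
    (hX : X ∈ TraceClass I) : L X ∈ TraceClass J :=
  (Submodule.span_le (p := (TraceClass J).comap L)).2 hL hX

theorem isPosTraceClass_submatrix {I : Type u} {J : Type v} {X : Matrix I I ℂ}
    (hX : IsPosTraceClass X) {f : J → I} (hf : Function.Injective f) :
    IsPosTraceClass (X.submatrix f f) :=
  isPosTraceClass_iff.2 ⟨hX.posSemidef.submatrix f, hX.2.comp_injective hf⟩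

/-- The block `(1 ⊗ ⟨r|) X (1 ⊗ |r'⟩)` of a trace-class operator `X` on `I × R`. -/
def block {I : Type u} {R : Type v} (r r' : R) : TraceClass (I × R) →ₗ[ℂ] TraceClass I where
  toFun X := ⟨Matrix.of fun i j => X.1 (i, r) (j, r'), by
    obtain ⟨X, hX⟩ := X
    induction hX using Submodule.span_induction with
    | mem X hX =>
      obtain ⟨H, _, _, _, g, hg⟩ := exists_gram hX.posSemidef
      have hs := summable_norm_sq_of_gram hg hX.2
      exact mem_traceClass_of_inner (fun i => g (i, r)) (fun i => g (i, r')) (fun i j => hg _ _)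
        (hs.comp_injective fun i j h => (Prod.ext_iff.1 h).1)
        (hs.comp_injective fun i j h => (Prod.ext_iff.1 h).1)
    | zero => exact (TraceClass I).zero_mem
    | add X Y _ _ hX hY => exact (TraceClass I).add_mem hX hY
    | smul c X _ hX => exact (TraceClass I).smul_mem c hX⟩
  map_add' _ _ := rfl
  map_smul' _ _ := rfl

/-- The map `Φ ⊗ id_R`, computed blockwise: the `(r, r')` block of `(Φ ⊗ id_R) X` is `Φ` of the
`(r, r')` block of `X`. Its values are in the trace class when `Φ` is a channel (see `tensorId`). -/
def ampliate {I : Type u} {J : Type u} (Φ : TraceClass I →ₗ[ℂ] TraceClass J) (R : Type v) :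
    TraceClass (I × R) →ₗ[ℂ] Matrix (J × R) (J × R) ℂ where
  toFun X := Matrix.of fun p q => (Φ (block p.2 q.2 X)).1 p.1 q.1
  map_add' X Y := by ext p q; simp
  map_smul' c X := by ext p q; simp

/-- A CPTP map from the system `I` to the system `J`: a linear map on trace-class operators which is
completely positive (`Φ ⊗ id` on `ℂ^k` preserves positivity for every `k`) and trace preserving. -/
structure Channel (I J : Type u) where
  toLinearMap : TraceClass I →ₗ[ℂ] TraceClass J
  completelyPositive : ∀ (k : ℕ) (X : TraceClass (I × Fin k)),
    IsPosTraceClass X.1 → IsPosTraceClass (ampliate toLinearMap (Fin k) X)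
  tracePreserving : ∀ X : TraceClass I, trace (toLinearMap X) = trace X

theorem posSemidef_of_finite {J : Type u} {R : Type v} {M : Matrix (J × R) (J × R) ℂ}
    (h : ∀ (k : ℕ) (f : Fin k → R), Function.Injective f →
      (M.submatrix (Prod.map id f) (Prod.map id f) : Matrix (J × Fin k) _ ℂ).PosSemidef) :
    M.PosSemidef := by
  classical
  have key : ∀ F : Finset R, ∃ (k : ℕ) (f : Fin k → R), Function.Injective f ∧
      ∀ r ∈ F, ∃ a, f a = r := fun F =>
    ⟨F.card, fun a => (F.equivFin.symm a : R),
      Subtype.val_injective.comp F.equivFin.symm.injective,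
      fun r hr => ⟨F.equivFin ⟨r, hr⟩, by simp⟩⟩
  refine ⟨?_, fun x => ?_⟩
  · ext ⟨j, r⟩ ⟨j', r'⟩
    obtain ⟨k, f, hf, hF⟩ := key {r, r'}
    obtain ⟨a, rfl⟩ := hF r (by simp)
    obtain ⟨b, rfl⟩ := hF r' (by simp)
    exact (h k f hf).1.apply (j, a) (j', b)
  · obtain ⟨k, f, hf, hF⟩ := key (x.support.image Prod.snd)
    have hinj : Function.Injective (Prod.map id f : J × Fin k → J × R) :=
      Function.injective_id.prodMap hf
    have hx : (x.comapDomain (Prod.map id f) hinj.injOn).mapDomain (Prod.map id f) = x := by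
      refine Finsupp.mapDomain_comapDomain _ hinj _ fun p hp => ?_
      obtain ⟨a, ha⟩ := hF p.2 (Finset.mem_image_of_mem _ hp)
      exact ⟨(p.1, a), by simp [ha]⟩
    have := (h k f hf).2 (x.comapDomain (Prod.map id f) hinj.injOn)
    rw [← hx]
    simpa [Finsupp.sum_mapDomain_index, add_mul, mul_add] using this

theorem Channel.ampliate_pos {I J : Type u} (Φ : Channel I J) (R : Type v)
    (X : TraceClass (I × R)) (hX : IsPosTraceClass X.1) :
    IsPosTraceClass (ampliate Φ.toLinearMap R X) := by
  have hpsd : (ampliate Φ.toLinearMap R X).PosSemidef := by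
    refine posSemidef_of_finite fun k f hf => ?_
    have hX' := isPosTraceClass_submatrix hX (Function.injective_id.prodMap hf)
    exact (Φ.completelyPositive k ⟨_, Submodule.subset_span hX'⟩ hX').posSemidef
  refine isPosTraceClass_iff.2 ⟨hpsd, ?_⟩
  have hre : ∀ p, ampliate Φ.toLinearMap R X p p
      = (((ampliate Φ.toLinearMap R X p p).re : ℝ) : ℂ) := fun p =>
    Complex.ext rfl (by simpa using (Complex.le_def.1 (hpsd.diag_nonneg (i := p))).2.symm)
  suffices hs : Summable fun p : R × J => (ampliate Φ.toLinearMap R X p.swap p.swap).re by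
    have := (Equiv.prodComm J R).summable_iff.2 hs
    exact ((Complex.hasSum_ofReal.2 this.hasSum).summable).congr fun p => (hre p).symm
  have hsd : ∀ r, Summable fun j => (Φ.toLinearMap (block r r X)).1 j j := fun r =>
    summable_diag (Φ.toLinearMap (block r r X)).2
  refine (summable_prod_of_nonneg fun p =>
    (Complex.le_def.1 (hpsd.diag_nonneg (i := p.swap))).1).2
      ⟨fun r => (Complex.hasSum_re (hsd r).hasSum).summable, ?_⟩
  have h1 : ∀ r, ∑' j, ((Φ.toLinearMap (block r r X)).1 j j).re
      = (∑' i, X.1 (i, r) (i, r)).re := fun r => by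
    rw [← Complex.re_tsum (hsd r)]
    exact congrArg Complex.re (Φ.tracePreserving (block r r X))
  refine Summable.congr ?_ fun r => (h1 r).symm
  have h2 := (Equiv.prodComm R I).summable_iff.2 (summable_diag X.2)
  exact (Complex.hasSum_re h2.prod.hasSum).summable

theorem Channel.ampliate_mem {I J : Type u} (Φ : Channel I J) (R : Type v)
    (X : TraceClass (I × R)) : ampliate Φ.toLinearMap R X ∈ TraceClass (J × R) := by
  obtain ⟨X, hX⟩ := X
  induction hX using Submodule.span_induction with
  | mem X hX => exact Submodule.subset_span (Φ.ampliate_pos R _ hX)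
  | zero => exact (map_zero (ampliate Φ.toLinearMap R)).symm ▸ Submodule.zero_mem _
  | add X Y hX hY h1 h2 =>
    exact (map_add (ampliate Φ.toLinearMap R) ⟨X, hX⟩ ⟨Y, hY⟩).symm ▸ Submodule.add_mem _ h1 h2
  | smul c X hX h =>
    exact (map_smul (ampliate Φ.toLinearMap R) c ⟨X, hX⟩).symm ▸ Submodule.smul_mem _ c h

namespace Channel

variable {I J K : Type u}

/-- Composition of channels, `Ψ ∘ Φ`. -/
def comp (Ψ : Channel J K) (Φ : Channel I J) : Channel I K where
  toLinearMap := Ψ.toLinearMap ∘ₗ Φ.toLinearMap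
  completelyPositive k X hX :=
    Ψ.completelyPositive k ⟨_, Φ.ampliate_mem (Fin k) X⟩ (Φ.completelyPositive k X hX)
  tracePreserving X := (Ψ.tracePreserving _).trans (Φ.tracePreserving X)

/-- The canonical identification of two systems along a bijection of their basis labels. It is only
used to reorder the tensor factors of a composite system. -/
def relabel (e : I ≃ J) : Channel I J where
  toLinearMap :=
    { toFun := fun X => ⟨X.1.submatrix e.symm e.symm, by
        obtain ⟨X, hX⟩ := X
        induction hX using Submodule.span_induction with
        | mem X hX =>
          exact Submodule.subset_span (isPosTraceClass_submatrix hX e.symm.injective)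
        | zero => exact Submodule.zero_mem _
        | add X Y _ _ hX hY => exact Submodule.add_mem _ hX hY
        | smul c X _ hX => exact Submodule.smul_mem _ c hX⟩
      map_add' := fun _ _ => rfl
      map_smul' := fun _ _ => rfl }
  completelyPositive k X hX :=
    isPosTraceClass_submatrix hX (e.symm.injective.prodMap Function.injective_id)
  tracePreserving X := e.symm.tsum_eq fun i => X.1 i i

/-- The channel `Φ ⊗ id_R`. -/
def tensorId (Φ : Channel I J) (R : Type u) : Channel (I × R) (J × R) where
  toLinearMap := (ampliate Φ.toLinearMap R).codRestrict (TraceClass (J × R)) (Φ.ampliate_mem R)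
  completelyPositive k X hX := by
    have hX' := isPosTraceClass_submatrix hX (Equiv.prodAssoc I R (Fin k)).symm.injective
    have := Φ.ampliate_pos (R × Fin k) ⟨_, Submodule.subset_span hX'⟩ hX'
    exact isPosTraceClass_submatrix this (Equiv.prodAssoc J R (Fin k)).injective
  tracePreserving X := by
    change ∑' p, ampliate Φ.toLinearMap R X p p = ∑' p, X.1 p p
    have h1 := (Equiv.prodComm R J).summable_iff.2 (summable_diag (Φ.ampliate_mem R X))
    have h2 := (Equiv.prodComm R I).summable_iff.2 (summable_diag X.2)
    rw [← (Equiv.prodComm R J).tsum_eq, ← (Equiv.prodComm R I).tsum_eq]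
    refine (h1.tsum_prod).trans (Eq.trans ?_ h2.tsum_prod.symm)
    exact tsum_congr fun r => Φ.tracePreserving (block r r X)

end Channel

/-- The partial trace over the first factor. -/
def traceLeft {A B : Type u} (X : TraceClass (A × B)) : Matrix B B ℂ :=
  Matrix.of fun b b' => ∑' a, X.1 (a, b) (a, b')

/-- `S` does not signal to `R'` in `Φ : SR → S'R'`: no local operation on `S` before `Φ` can be
detected at `R'` alone, i.e. `tr_{S'} ∘ Φ = tr_{S'} ∘ Φ ∘ (M ⊗ id_R)` for all channels `M` on `S`. -/
def DoesNotSignal {S R S' R' : Type u} (Φ : Channel (S × R) (S' × R')) : Prop :=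
  ∀ (M : Channel S S) (X : TraceClass (S × R)),
    traceLeft (Φ.toLinearMap X) = traceLeft ((Φ.comp (M.tensorId R)).toLinearMap X)

/-- Input of a multi-round channel, with the round-`i` input system `S i` put first. -/
def inputSplit {n : ℕ} (S : Fin n → Type u) (E₀ : Type u) (i : Fin n) :
    (E₀ × ∀ j, S j) ≃ S i × (E₀ × ∀ j : {j // j ≠ i}, S j) :=
  ((Equiv.refl E₀).prodCongr (Equiv.piSplitAt i S)).trans
    { toFun := fun p => (p.2.1, (p.1, p.2.2))
      invFun := fun p => (p.2.1, (p.1, p.2.2))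
      left_inv := fun _ => rfl
      right_inv := fun _ => rfl }

/-- Output of a multi-round channel, with the outputs of the rounds before `i` put last. -/
def outputSplit {n : ℕ} (S' : Fin n → Type u) (En : Type u) (i : Fin n) :
    ((∀ j, S' j) × En) ≃
      ((∀ j : {j // ¬ j < i}, S' j) × En) × (∀ j : {j // j < i}, S' j) :=
  ((Equiv.piEquivPiSubtypeProd (fun j => j < i) S').prodCongr (Equiv.refl En)).trans
    { toFun := fun p => ((p.1.2, p.2), p.1.1)
      invFun := fun p => ((p.2, p.1.1), p.1.2)
      left_inv := fun _ => rfl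
      right_inv := fun _ => rfl }

/-- In the channel `Φ` from `E₀ S_1 … S_n` to `S'_1 … S'_n E_n`, the input `S i` does not signal to
the joint output of all rounds before `i`. -/
def NoSignalToEarlier {n : ℕ} {S S' : Fin n → Type u} {E₀ En : Type u}
    (Φ : Channel (E₀ × ∀ j, S j) ((∀ j, S' j) × En)) (i : Fin n) : Prop :=
  DoesNotSignal (((Channel.relabel (outputSplit S' En i)).comp Φ).comp
    (Channel.relabel (inputSplit S E₀ i).symm))

/-- A list of channels `Φ_j : E_{j-1} S_j → S'_j E_j`, `j = 1, …, n`, for some memory systems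
`E_1, …, E_{n-1}`, where `E₀` and `E_n` are prescribed. -/
inductive ChannelSequence : {n : ℕ} → (S S' : Fin n → Type u) → (E₀ En : Type u) → Type (u + 1)
  | nil {S S' : Fin 0 → Type u} {E₀ : Type u} : ChannelSequence S S' E₀ E₀
  | snoc {n : ℕ} {S S' : Fin (n + 1) → Type u} {E₀ E E' : Type u}
      (c : ChannelSequence (fun i => S i.castSucc) (fun i => S' i.castSucc) E₀ E)
      (Φ : Channel (E × S (Fin.last n)) (S' (Fin.last n) × E')) : ChannelSequence S S' E₀ E'

/-- Split off the last system of a family. -/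
def lastEquiv {n : ℕ} (S : Fin (n + 1) → Type u) :
    (∀ i, S i) ≃ (∀ i : Fin n, S i.castSucc) × S (Fin.last n) :=
  (Fin.snocEquiv S).symm.trans (Equiv.prodComm _ _)

/-- The sequential composition of `Φ_1, …, Φ_n`, in this order, each tensored with the identity on
all the other systems present: for `j` this is `S'_1, …, S'_{j-1}` (already produced), `S_{j+1}, …,
S_n` (not yet used) and the spectator `R`. -/
def ChannelSequence.composeWith : {n : ℕ} → {S S' : Fin n → Type u} → {E₀ En : Type u} →
    ChannelSequence S S' E₀ En → (R : Type u) →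
    Channel ((E₀ × ∀ i, S i) × R) (((∀ i, S' i) × En) × R)
  | _, _, _, _, _, .nil, _ => Channel.relabel
      { toFun := fun p => ((fun i => i.elim0, p.1.1), p.2)
        invFun := fun p => ((p.1.2, fun i => i.elim0), p.2)
        left_inv := fun p => Prod.ext (Prod.ext rfl (Subsingleton.elim _ _)) rfl
        right_inv := fun p => Prod.ext (Prod.ext (Subsingleton.elim _ _) rfl) rfl }
  | _, S, S', _, _, .snoc c Φ, R =>
      (Channel.relabel
        { toFun := fun p => (((lastEquiv S').symm (p.2.1, p.1.1), p.1.2), p.2.2)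
          invFun := fun p => (((lastEquiv S' p.1.1).2, p.1.2), ((lastEquiv S' p.1.1).1, p.2))
          left_inv := fun p => by simp
          right_inv := fun p => by simp }).comp <|
      (Φ.tensorId ((∀ i : Fin _, S' i.castSucc) × R)).comp <|
      (Channel.relabel
        { toFun := fun p => ((p.1.2, p.2.1), (p.1.1, p.2.2))
          invFun := fun p => ((p.2.1, p.1.1), (p.1.2, p.2.2))
          left_inv := fun _ => rfl
          right_inv := fun _ => rfl }).comp <|
      (c.composeWith (S (Fin.last _) × R)).comp <|
      Channel.relabel
        { toFun := fun p => ((p.1.1, (lastEquiv S p.1.2).1), ((lastEquiv S p.1.2).2, p.2))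
          invFun := fun p => ((p.1.1, (lastEquiv S).symm (p.1.2, p.2.1)), p.2.2)
          left_inv := fun p => by simp
          right_inv := fun p => by simp }

/-- `(id ⊗ Φ_n) ∘ ⋯ ∘ (id ⊗ Φ_2 ⊗ id) ∘ (Φ_1 ⊗ id)`, without spectator. -/
def ChannelSequence.compose {n : ℕ} {S S' : Fin n → Type u} {E₀ En : Type u}
    (c : ChannelSequence S S' E₀ En) : Channel (E₀ × ∀ i, S i) ((∀ i, S' i) × En) :=
  (Channel.relabel (Equiv.prodPUnit.{u} _)).comp <|
    (c.composeWith PUnit.{u + 1}).comp (Channel.relabel (Equiv.prodPUnit.{u} _).symm)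

end Quantum

end

/-!
The theorem is the iterated form of "semicausal channels are semilocalizable". Let `Φ : A S → B C` be
a channel in which `S` does not signal to `B`. A Gram decomposition of its Choi matrix
(`Channel.exists_choi_gram`) gives a Stinespring isometry of `Φ`, with components `W b (a, s)` in
`ℓ²(C) ⊗ ℓ²(κ)`, and no-signalling says that
`⟨W b' (a', s'), W b (a, s)⟩ = δ_{s s'} ⟨W b' (a', t), W b (a, t)⟩` for every fixed label `t`
(`DoesNotSignal.matUnit`). Let `f (b, a)` be the vectors `W b (a, t)` written in a Hilbert basis `E` of
their closed span. They are the components of a minimal Stinespring isometry `ℓ²(A) → ℓ²(B) ⊗ ℓ²(E)`.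
The vectors `f (b, a) ⊗ |s⟩` are total in `ℓ²(E) ⊗ ℓ²(S)` and have the Gram matrix of the `W b (a, s)`,
so there is an isometry `ℓ²(E) ⊗ ℓ²(S) → ℓ²(C) ⊗ ℓ²(κ)` sending the former to the latter. The channels
of these two isometries, `Ψ : A → B E` and `Γ : E S → C`, compose to `Φ` (`exists_eq_sequential`).

For `n + 1` rounds this is applied with the last input as `S` and the outputs of the first `n` rounds
as `B`; the reduced outputs of `Ψ` are those of `Φ`, so `Ψ` satisfies the hypothesis for `n` rounds and
the induction goes on (`exists_channelSequence`).

Dimensions are arbitrary, so two facts about channels have to be shown along the way: that an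
isometry `V` defines a channel `X ↦ tr_K (V X V*)` (`stine`), where positivity and trace preservation
come from the invariance of the Hilbert–Schmidt norm, and that a channel is determined by its values
on matrix units (`Channel.ext_of_ketbra`), which is continuity for the trace norm.
-/

noncomputable section

namespace Quantum

/-! ### Vectors and operators on `ℓ²(I)` -/

theorem inner_ket {I : Type u} (i : I) (x : Ell2 I) : inner ℂ (ket i) x = x i := by
  classical
  unfold ket
  convert lp.inner_single_left (𝕜 := ℂ) (G := fun _ : I => ℂ) i (1 : ℂ) x using 1
  simp

theorem inner_ket_right {I : Type u} (i : I) (x : Ell2 I) :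
    inner ℂ x (ket i) = star (x i) := by
  rw [← inner_ket, RCLike.star_def, inner_conj_symm]

theorem Ell2.inner_eq {I : Type u} (x y : Ell2 I) :
    inner ℂ x y = ∑' i, y i * star (x i) := by
  rw [lp.inner_eq_tsum]; rfl

theorem Ell2.summable_inner {I : Type u} (x y : Ell2 I) :
    Summable fun i => y i * star (x i) := lp.summable_inner (𝕜 := ℂ) x y

theorem Ell2.summable_norm_sq {I : Type u} (x : Ell2 I) : Summable fun i => ‖x i‖ ^ 2 := by
  simpa using (lp.memℓp x).summable (p := 2) (by norm_num)

theorem Ell2.norm_sq_eq {I : Type u} (x : Ell2 I) : ‖x‖ ^ 2 = ∑' i, ‖x i‖ ^ 2 := by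
  have := lp.norm_rpow_eq_tsum (p := 2) (by norm_num) x
  simpa using this

theorem memℓp_two_of_summable {I : Type*} {E : I → Type*} [∀ i, NormedAddCommGroup (E i)]
    {x : ∀ i, E i} (h : Summable fun i => ‖x i‖ ^ 2) : Memℓp x 2 :=
  memℓp_gen (by simpa using h)

/-- The vector of `ℓ²(I)` with a given square-summable family of coordinates. -/
def Ell2.mk {I : Type u} (x : I → ℂ) (h : Summable fun i => ‖x i‖ ^ 2) : Ell2 I :=
  ⟨x, memℓp_two_of_summable h⟩

@[simp] theorem Ell2.mk_apply {I : Type u} (x : I → ℂ) (h : Summable fun i => ‖x i‖ ^ 2) (i : I) :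
    Ell2.mk x h i = x i := rfl

open Classical in
theorem ket_apply {I : Type u} (i j : I) : (ket i : Ell2 I) j = if i = j then 1 else 0 := by
  rw [ket, lp.single_apply, Pi.single_apply]
  simp [eq_comm]

theorem Ell2.continuousLinearMap_ext {I : Type u} {H : Type*} [NormedAddCommGroup H]
    [NormedSpace ℂ H] {A B : Ell2 I →L[ℂ] H} (h : ∀ i, A (ket i) = B (ket i)) : A = B := by
  classical
  refine lp.ext_continuousLinearMap (by norm_num) fun i => ?_
  ext
  have := h i
  unfold ket at this
  simpa using this

theorem Ell2.operator_ext {I : Type u} {A B : Ell2 I →L[ℂ] Ell2 I}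
    (h : ∀ i j, inner ℂ (ket i) (A (ket j)) = inner ℂ (ket i) (B (ket j))) : A = B := by
  refine Ell2.continuousLinearMap_ext fun j => lp.ext (funext fun i => ?_)
  simpa only [inner_ket] using h i j

/-- A square-summable family of vectors is the family of columns of a bounded operator. -/
theorem exists_operator_of_columns {I : Type u} {H : Type*} [NormedAddCommGroup H]
    [InnerProductSpace ℂ H] [CompleteSpace H] (g : I → H) (hg : Summable fun i => ‖g i‖ ^ 2) :
    ∃ A : Ell2 I →L[ℂ] H, ∀ i, A (ket i) = g i := by
  have key : ∀ x : Ell2 I, Summable (fun i => ‖x i‖ * ‖g i‖) ∧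
      ∑' i, ‖x i‖ * ‖g i‖ ≤ Real.sqrt (∑' i, ‖g i‖ ^ 2) * ‖x‖ := fun x => by
    have := Real.summable_and_inner_le_Lp_mul_Lq_tsum_of_nonneg (p := 2) (q := 2)
      (f := fun i => ‖x i‖) (g := fun i => ‖g i‖) ⟨by norm_num, by norm_num, by norm_num⟩
      (fun i => norm_nonneg _) (fun i => norm_nonneg _)
      (by simpa using x.summable_norm_sq) (by simpa using hg)
    refine ⟨this.1, this.2.trans (le_of_eq ?_)⟩
    rw [mul_comm, lp.norm_eq_tsum_rpow (p := 2) (by norm_num), Real.sqrt_eq_rpow]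
    simp
  have hsum : ∀ x : Ell2 I, Summable fun i => x i • g i := fun x =>
    Summable.of_norm (by simpa [norm_smul] using (key x).1)
  refine ⟨LinearMap.mkContinuous
    { toFun := fun x => ∑' i, x i • g i
      map_add' := fun x y => by
        rw [← (hsum x).tsum_add (hsum y)]
        exact tsum_congr fun i => by simp [add_smul]
      map_smul' := fun c x => by
        rw [RingHom.id_apply, ← (hsum x).tsum_const_smul]
        exact tsum_congr fun i => by simp [mul_smul] }
    (Real.sqrt (∑' i, ‖g i‖ ^ 2)) (fun x => by
      refine (norm_tsum_le_tsum_norm (by simpa [norm_smul] using (key x).1)).trans ?_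
      simpa [norm_smul] using (key x).2), fun i => ?_⟩
  change ∑' j, (ket i : Ell2 I) j • g j = g i
  rw [tsum_eq_single i]
  · simp [ket]
  · intro j hj; simp [ket, hj]

open Classical in
/-- An orthonormal family is the family of columns of an isometry. -/
theorem exists_isometry_of_orthonormal {I : Type u} {H : Type*} [NormedAddCommGroup H]
    [InnerProductSpace ℂ H] [CompleteSpace H] (w : I → H)
    (hw : ∀ i j, inner ℂ (w i) (w j) = if i = j then (1 : ℂ) else 0) :
    ∃ V : Ell2 I →ₗᵢ[ℂ] H, ∀ i, V (ket i) = w i := by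
  have h : Orthonormal ℂ w := orthonormal_iff_ite.2 hw
  refine ⟨h.orthogonalFamily.linearIsometry, fun i => ?_⟩
  unfold ket
  rw [OrthogonalFamily.linearIsometry_apply_single]
  simp

/-- The Gram matrix of any family is that of a total family in some `ℓ²(κ)`: express the family in a
Hilbert basis of its closed span. -/
theorem exists_total_family {I H : Type u} [NormedAddCommGroup H] [InnerProductSpace ℂ H]
    [CompleteSpace H] (g : I → H) :
    ∃ (κ : Type u) (f : I → Ell2 κ), (∀ i j, inner ℂ (f i) (f j) = inner ℂ (g i) (g j)) ∧
      ∀ x : Ell2 κ, (∀ i, inner ℂ (f i) x = 0) → x = 0 := by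
  let M : Submodule ℂ H := (Submodule.span ℂ (Set.range g)).topologicalClosure
  have hgM : ∀ i, g i ∈ M := fun i =>
    Submodule.le_topologicalClosure _ (Submodule.subset_span ⟨i, rfl⟩)
  have : CompleteSpace M :=
    (Submodule.isClosed_topologicalClosure _).completeSpace_coe
  obtain ⟨w, b, -⟩ := exists_hilbertBasis ℂ M
  refine ⟨w, fun i => b.repr ⟨g i, hgM i⟩, fun i j => ?_, fun x hx => ?_⟩
  · rw [LinearIsometryEquiv.inner_map_map]; rfl
  · obtain ⟨y, rfl⟩ := b.repr.surjective x
    simp only [LinearIsometryEquiv.inner_map_map] at hx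
    have h1 : (y : H) ∈ (Submodule.span ℂ (Set.range g))ᗮ := by
      rw [Submodule.mem_orthogonal]
      intro z hz
      induction hz using Submodule.span_induction with
      | mem z hz => obtain ⟨i, rfl⟩ := hz; exact hx i
      | zero => simp
      | add a b _ _ ha hb => rw [inner_add_left, ha, hb, add_zero]
      | smul c a _ ha => rw [inner_smul_left, ha, mul_zero]
    have h2 : (y : H) ∈ Mᗮ := by rwa [Submodule.orthogonal_closure]
    have h3 : inner ℂ (y : H) (y : H) = 0 := (Submodule.mem_orthogonal _ _).1 h2 _ y.2
    have h4 : y = 0 := Subtype.ext (inner_self_eq_zero.1 h3)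
    rw [h4, map_zero]

theorem exists_gram_ell2 {I : Type u} {X : Matrix I I ℂ} (h : X.PosSemidef) :
    ∃ (κ : Type u) (g : I → Ell2 κ), ∀ i j, X i j = inner ℂ (g i) (g j) := by
  obtain ⟨H, _, _, _, g, hg⟩ := exists_gram h
  obtain ⟨κ, f, hf, -⟩ := exists_total_family g
  exact ⟨κ, f, fun i j => (hg i j).trans (hf i j).symm⟩

/-- Two families with the same Gram matrix, the first of them total, are related by an isometry. -/
theorem exists_isometry_of_gram_eq {ι : Type*} {H G : Type*} [NormedAddCommGroup H]
    [InnerProductSpace ℂ H] [CompleteSpace H] [NormedAddCommGroup G] [InnerProductSpace ℂ G]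
    [CompleteSpace G] (f : ι → H) (g : ι → G)
    (hfg : ∀ i j, inner ℂ (f i) (f j) = inner ℂ (g i) (g j))
    (hf : ∀ x : H, (∀ i, inner ℂ (f i) x = 0) → x = 0) :
    ∃ U : H →ₗᵢ[ℂ] G, ∀ i, U (f i) = g i := by
  let F : (ι →₀ ℂ) →ₗ[ℂ] H := Finsupp.linearCombination ℂ f
  let L : (ι →₀ ℂ) →ₗ[ℂ] G := Finsupp.linearCombination ℂ g
  have hinner : ∀ c, inner ℂ (L c) (L c) = inner ℂ (F c) (F c) := fun c => by
    simp only [L, F, Finsupp.linearCombination_apply, Finsupp.sum_inner, Finsupp.inner_sum, hfg,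
      inner_smul_left, inner_smul_right]
  have hnorm : ∀ c, ‖L c‖ = ‖F c‖ := fun c => by
    rw [norm_eq_sqrt_re_inner (𝕜 := ℂ), norm_eq_sqrt_re_inner (𝕜 := ℂ), hinner]
  have hd : DenseRange F := by
    have h1 : (LinearMap.range F).topologicalClosure = ⊤ := by
      rw [Submodule.topologicalClosure_eq_top_iff, Submodule.eq_bot_iff]
      intro x hx
      refine hf x fun i => ?_
      refine (Submodule.mem_orthogonal _ _).1 hx _ ⟨Finsupp.single i 1, ?_⟩
      simp [F]
    rw [DenseRange, ← LinearMap.coe_range]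
    exact Submodule.dense_iff_topologicalClosure_eq_top.2 h1
  have hb : ∀ c, ‖L c‖ ≤ 1 * ‖F c‖ := fun c => by rw [one_mul, hnorm]
  have hU : ∀ c, L.extendOfNorm F (F c) = L c := LinearMap.extendOfNorm_eq hd ⟨1, hb⟩
  refine ⟨⟨(L.extendOfNorm F : H →L[ℂ] G).toLinearMap, fun x => ?_⟩, fun i => ?_⟩
  · refine hd.induction_on (p := fun x => ‖L.extendOfNorm F x‖ = ‖x‖) x ?_ fun c => ?_
    · exact isClosed_eq (by fun_prop) (by fun_prop)
    · rw [hU, hnorm]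
  · have := hU (Finsupp.single i 1)
    simpa [F, L] using this

theorem tsum_enorm_sq_ne_top_iff {ι : Type*} {E : ι → Type*} [∀ i, NormedAddCommGroup (E i)]
    {x : ∀ i, E i} : ∑' i, ‖x i‖ₑ ^ 2 ≠ ⊤ ↔ Summable fun i => ‖x i‖ ^ 2 := by
  have h : ∀ i, ‖x i‖ₑ ^ 2 = ((‖x i‖₊ ^ 2 : NNReal) : ENNReal) := fun i => by
    rw [enorm_eq_nnnorm, ENNReal.coe_pow]
  simp only [h, ENNReal.tsum_coe_ne_top_iff_summable]
  rw [← NNReal.summable_coe]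
  simp

theorem tsum_norm_sq_eq_toReal {ι : Type*} {E : ι → Type*} [∀ i, NormedAddCommGroup (E i)]
    (x : ∀ i, E i) : ∑' i, ‖x i‖ ^ 2 = (∑' i, ‖x i‖ₑ ^ 2).toReal := by
  rw [ENNReal.tsum_toReal_eq (fun i => by simp)]
  simp

theorem Ell2.enorm_sq_eq {I : Type u} (x : Ell2 I) : ‖x‖ₑ ^ 2 = ∑' i, ‖x i‖ₑ ^ 2 := by
  have h := tsum_enorm_sq_ne_top_iff.2 x.summable_norm_sq
  rw [← ENNReal.toReal_eq_toReal_iff' (by simp) h, ← tsum_norm_sq_eq_toReal, ← x.norm_sq_eq]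
  simp

/-- The Hilbert–Schmidt norm of an operator is that of its adjoint. -/
theorem tsum_enorm_sq_adjoint {I κ : Type u} (A : Ell2 I →L[ℂ] Ell2 κ) :
    ∑' k, ‖A.adjoint (ket k)‖ₑ ^ 2 = ∑' i, ‖A (ket i)‖ₑ ^ 2 := by
  simp only [Ell2.enorm_sq_eq]
  rw [ENNReal.tsum_comm]
  refine tsum_congr fun i => tsum_congr fun k => ?_
  have : (A.adjoint (ket k)) i = star ((A (ket i)) k) := by
    rw [← inner_ket, ContinuousLinearMap.adjoint_inner_right, inner_ket_right]
  rw [this, enorm_eq_nnnorm, enorm_eq_nnnorm, nnnorm_star]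

/-- The Hilbert–Schmidt norm is not changed by composition with a co-isometry. -/
theorem tsum_enorm_sq_comp_adjoint {I P κ : Type u} (A : Ell2 I →L[ℂ] Ell2 κ)
    (V : Ell2 I →ₗᵢ[ℂ] Ell2 P) :
    ∑' p, ‖A (V.toContinuousLinearMap.adjoint (ket p))‖ₑ ^ 2 = ∑' i, ‖A (ket i)‖ₑ ^ 2 := by
  rw [← tsum_enorm_sq_adjoint A]
  refine (tsum_enorm_sq_adjoint (A ∘L V.toContinuousLinearMap.adjoint)).symm.trans ?_
  refine tsum_congr fun k => ?_
  rw [ContinuousLinearMap.adjoint_comp, ContinuousLinearMap.adjoint_adjoint]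
  simp [enorm_eq_nnnorm]

/-! ### Trace-class matrices and their operators -/

theorem TraceClass.induction {I : Type u} {p : TraceClass I → Prop}
    (pos : ∀ X : TraceClass I, IsPosTraceClass X.1 → p X) (zero : p 0)
    (add : ∀ X Y, p X → p Y → p (X + Y)) (smul : ∀ (c : ℂ) X, p X → p (c • X))
    (X : TraceClass I) : p X := by
  obtain ⟨X, hX⟩ := X
  induction hX using Submodule.span_induction with
  | mem X hX => exact pos ⟨X, _⟩ hX
  | zero => exact zero
  | add X Y hX hY h1 h2 => exact add ⟨X, hX⟩ ⟨Y, hY⟩ h1 h2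
  | smul c X hX h => exact smul c ⟨X, hX⟩ h

/-- The operator `|φ⟩⟨ψ|`. -/
def ketbra {I : Type u} (φ ψ : Ell2 I) : TraceClass I :=
  ⟨Matrix.of fun i j => φ i * star (ψ j),
    mem_traceClass_of_inner (H := ℂ) (fun i => star (φ i)) (fun j => star (ψ j))
      (fun i j => by simp [mul_comm]) (by simpa using φ.summable_norm_sq)
      (by simpa using ψ.summable_norm_sq)⟩

theorem ketbra_apply {I : Type u} (φ ψ : Ell2 I) (i j : I) :
    (ketbra φ ψ).1 i j = φ i * star (ψ j) := rfl

theorem trace_ketbra {I : Type u} (φ ψ : Ell2 I) : trace (ketbra φ ψ) = inner ℂ ψ φ :=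
  (Ell2.inner_eq ψ φ).symm

/-- A positive trace-class matrix is the Gram matrix of the columns of a Hilbert–Schmidt operator. -/
theorem IsPosTraceClass.exists_columns {I : Type u} {X : Matrix I I ℂ} (h : IsPosTraceClass X) :
    ∃ (κ : Type u) (g : I → Ell2 κ), (∀ i j, X i j = inner ℂ (g i) (g j)) ∧
      Summable fun i => ‖g i‖ ^ 2 := by
  obtain ⟨κ, g, hg⟩ := exists_gram_ell2 h.posSemidef
  exact ⟨κ, g, hg, summable_norm_sq_of_gram hg h.2⟩

theorem exists_op {I : Type u} (X : TraceClass I) :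
    ∃ T : Ell2 I →L[ℂ] Ell2 I, ∀ i j, inner ℂ (ket i) (T (ket j)) = X.1 i j := by
  induction X using TraceClass.induction with
  | pos X hX =>
    obtain ⟨⟨T, -, hT⟩, -⟩ := hX
    exact ⟨T, fun i j => (hT i j).symm⟩
  | zero => exact ⟨0, by simp⟩
  | add X Y hX hY =>
    obtain ⟨T, hT⟩ := hX
    obtain ⟨T', hT'⟩ := hY
    exact ⟨T + T', by simp [hT, hT']⟩
  | smul c X hX =>
    obtain ⟨T, hT⟩ := hX
    exact ⟨c • T, by simp [hT]⟩

/-- The bounded operator with a given trace-class matrix. -/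
def op {I : Type u} (X : TraceClass I) : Ell2 I →L[ℂ] Ell2 I := (exists_op X).choose

theorem inner_op {I : Type u} (X : TraceClass I) (i j : I) :
    inner ℂ (ket i) (op X (ket j)) = X.1 i j := (exists_op X).choose_spec i j

theorem op_eq {I : Type u} {X : TraceClass I} {T : Ell2 I →L[ℂ] Ell2 I}
    (h : ∀ i j, inner ℂ (ket i) (T (ket j)) = X.1 i j) : op X = T :=
  Ell2.operator_ext fun i j => by rw [inner_op, h]

theorem op_add {I : Type u} (X Y : TraceClass I) : op (X + Y) = op X + op Y :=
  op_eq fun i j => by simp [inner_op]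

theorem op_smul {I : Type u} (c : ℂ) (X : TraceClass I) : op (c • X) = c • op X :=
  op_eq fun i j => by simp [inner_op]

theorem op_ketbra {I : Type u} (φ ψ : Ell2 I) (x : Ell2 I) :
    op (ketbra φ ψ) x = inner ℂ ψ x • φ := by
  rw [op_eq (T := (innerSL ℂ ψ).smulRight φ)]
  · simp
  · intro i j
    simp [inner_ket, inner_ket_right, ketbra_apply, mul_comm]

/-- If `X = A* A` on `I × R` and `A_r` denotes the restriction of `A` to the `r`-th copy of `ℓ²(I)`, then
the `(r, r')` block of `X` is `A_r* A_r'`. -/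
theorem op_block {I : Type u} {R : Type v} {κ : Type u} (X : TraceClass (I × R))
    {g : I × R → Ell2 κ} (hg : ∀ p q, X.1 p q = inner ℂ (g p) (g q))
    {A : R → Ell2 I →L[ℂ] Ell2 κ} (hA : ∀ r i, A r (ket i) = g (i, r)) (r r' : R) :
    op (block r r' X) = (A r).adjoint ∘L A r' := by
  refine op_eq fun i j => ?_
  rw [ContinuousLinearMap.comp_apply, ContinuousLinearMap.adjoint_inner_right, hA, hA, ← hg]
  rfl

/-! ### The channel of a Stinespring isometry -/

section Stinespring

variable {I J K : Type u} (V : Ell2 I →ₗᵢ[ℂ] Ell2 (J × K))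

/-- The vector `V* |j k⟩`. -/
def costate (p : J × K) : Ell2 I := V.toContinuousLinearMap.adjoint (ket p)

theorem inner_costate (p : J × K) (x : Ell2 I) : inner ℂ (costate V p) x = V x p := by
  rw [costate, ContinuousLinearMap.adjoint_inner_left, inner_ket]; rfl

/-- `A V*` is Hilbert–Schmidt when `A` is. -/
theorem summable_costate {κ : Type u} {g : I → Ell2 κ} (hg : Summable fun i => ‖g i‖ ^ 2)
    {A : Ell2 I →L[ℂ] Ell2 κ} (hA : ∀ i, A (ket i) = g i) :
    Summable fun p => ‖A (costate V p)‖ ^ 2 := by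
  rw [← tsum_enorm_sq_ne_top_iff] at hg ⊢
  simpa only [costate, tsum_enorm_sq_comp_adjoint, hA] using hg

theorem tsum_costate {κ : Type u} {g : I → Ell2 κ}
    {A : Ell2 I →L[ℂ] Ell2 κ} (hA : ∀ i, A (ket i) = g i) :
    ∑' p, ‖A (costate V p)‖ ^ 2 = ∑' i, ‖g i‖ ^ 2 := by
  simp only [tsum_norm_sq_eq_toReal, costate, tsum_enorm_sq_comp_adjoint, hA]

theorem summable_stine (X : TraceClass I) (j j' : J) :
    Summable fun k => inner ℂ (costate V (j, k)) (op X (costate V (j', k))) := by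
  induction X using TraceClass.induction with
  | pos X hX =>
    obtain ⟨κ, g, hg, hs⟩ := hX.exists_columns
    obtain ⟨A, hA⟩ := exists_operator_of_columns g hs
    have hop : op X = A.adjoint ∘L A := op_eq fun i j => by
      rw [ContinuousLinearMap.comp_apply, ContinuousLinearMap.adjoint_inner_right, hA, hA, ← hg]
    have h := summable_costate V hs hA
    have hj : ∀ j, Memℓp (fun k => A (costate V (j, k))) 2 := fun j =>
      memℓp_two_of_summable (h.comp_injective (Prod.mk_right_injective j))
    simp only [hop, ContinuousLinearMap.comp_apply, ContinuousLinearMap.adjoint_inner_right]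
    exact lp.summable_inner (𝕜 := ℂ) (G := fun _ : K => Ell2 κ) ⟨_, hj j⟩ ⟨_, hj j'⟩
  | zero =>
    have : op (0 : TraceClass I) = 0 := op_eq fun i j => by simp
    simp [this]
  | add X Y hX hY => simpa [op_add] using hX.add hY
  | smul c X hX => simpa [op_smul] using hX.mul_left c

/-- The matrix of `tr_K (V X V*)`. -/
def stineMatrix : TraceClass I →ₗ[ℂ] Matrix J J ℂ where
  toFun X := Matrix.of fun j j' =>
    ∑' k, inner ℂ (costate V (j, k)) (op X (costate V (j', k)))
  map_add' X Y := by
    ext j j'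
    simp only [Matrix.of_apply, Matrix.add_apply]
    rw [← (summable_stine V X j j').tsum_add (summable_stine V Y j j')]
    simp [op_add]
  map_smul' c X := by
    ext j j'
    simp only [Matrix.of_apply, Matrix.smul_apply, RingHom.id_apply]
    rw [← (summable_stine V X j j').tsum_const_smul]
    simp [op_smul]

theorem stineMatrix_ketbra (φ ψ : Ell2 I) (j j' : J) :
    stineMatrix V (ketbra φ ψ) j j' = ∑' k, V φ (j, k) * star (V ψ (j', k)) := by
  refine tsum_congr fun k => ?_
  rw [op_ketbra, inner_smul_right, inner_costate, ← inner_costate V (j', k) ψ, RCLike.star_def,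
    inner_conj_symm, mul_comm]

/-- Blockwise, `tr_K (V X V*)` is the Gram matrix of the `ℓ²(K)`-valued family
`(j, r) ↦ (A_r V* |j k⟩)_k`, for `X = A* A`. -/
theorem stineMatrix_block_pos {R : Type} [Finite R] (X : TraceClass (I × R))
    (hX : IsPosTraceClass X.1) : IsPosTraceClass
      (Matrix.of fun p q : J × R => stineMatrix V (block p.2 q.2 X) p.1 q.1) := by
  obtain ⟨κ, g₀, hg₀⟩ := exists_gram_ell2 hX.posSemidef
  have hs₀ := summable_norm_sq_of_gram hg₀ hX.2
  have hs : ∀ r, Summable fun i => ‖g₀ (i, r)‖ ^ 2 := fun r =>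
    hs₀.comp_injective (Prod.mk_left_injective r)
  choose A hA using fun r => exists_operator_of_columns _ (hs r)
  have h := fun r => summable_costate V (hs r) (hA r)
  let w : J × R → lp (fun _ : K => Ell2 κ) 2 := fun p =>
    ⟨fun k => A p.2 (costate V (p.1, k)),
      memℓp_two_of_summable ((h p.2).comp_injective (Prod.mk_right_injective p.1))⟩
  have hw : ∀ p, ‖w p‖ ^ 2 = ∑' k, ‖A p.2 (costate V (p.1, k))‖ ^ 2 := fun p => by
    simpa using lp.norm_rpow_eq_tsum (p := 2) (by norm_num) (w p)
  convert isPosTraceClass_of_norm_sq w ?_ using 1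
  · ext p q
    refine Eq.trans ?_ (lp.inner_eq_tsum (𝕜 := ℂ) (w p) (w q)).symm
    refine tsum_congr fun k => ?_
    rw [op_block X hg₀ hA, ContinuousLinearMap.comp_apply,
      ContinuousLinearMap.adjoint_inner_right]
  · refine (Equiv.prodComm R J).summable_iff.1 ((summable_prod_of_nonneg fun _ => sq_nonneg _).2
      ⟨fun r => ?_, Summable.of_finite⟩)
    simp only [Equiv.prodComm_apply, Prod.swap, hw]
    exact (h r).prod

theorem stineMatrix_pos (X : TraceClass I) (hX : IsPosTraceClass X.1) :
    IsPosTraceClass (stineMatrix V X) := by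
  let e := (Equiv.prodPUnit.{0} I).symm
  have h := stineMatrix_block_pos V ((Channel.relabel e).toLinearMap X)
    (isPosTraceClass_submatrix hX e.symm.injective)
  exact isPosTraceClass_submatrix h (f := (Equiv.prodPUnit.{0} J).symm) (Equiv.injective _)

theorem stineMatrix_mem (X : TraceClass I) : stineMatrix V X ∈ TraceClass J := by
  induction X using TraceClass.induction with
  | pos X hX => exact Submodule.subset_span (stineMatrix_pos V X hX)
  | zero => rw [map_zero]; exact Submodule.zero_mem _
  | add X Y hX hY => rw [map_add]; exact Submodule.add_mem _ hX hY
  | smul c X hX => rw [map_smul]; exact Submodule.smul_mem _ c hX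

/-- The channel `X ↦ tr_K (V X V*)` of an isometry `V : ℓ²(I) → ℓ²(J) ⊗ ℓ²(K)`. -/
def stine : Channel I J where
  toLinearMap := (stineMatrix V).codRestrict (TraceClass J) (stineMatrix_mem V)
  completelyPositive _ X hX := stineMatrix_block_pos V X hX
  tracePreserving X := by
    induction X using TraceClass.induction with
    | pos X hX =>
      obtain ⟨κ, g, hg, hs⟩ := hX.exists_columns
      obtain ⟨A, hA⟩ := exists_operator_of_columns g hs
      have hop : op X = A.adjoint ∘L A := op_eq fun i j => by
        rw [ContinuousLinearMap.comp_apply, ContinuousLinearMap.adjoint_inner_right, hA, hA, ← hg]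
      have h := summable_costate V hs hA
      have h1 : trace X = ((∑' i, ‖g i‖ ^ 2 : ℝ) : ℂ) := by
        rw [Complex.ofReal_tsum]
        refine tsum_congr fun i => ?_
        rw [hg, inner_self_eq_norm_sq_to_K]; norm_cast
      rw [h1, ← tsum_costate V hA, Complex.ofReal_tsum,
        (Complex.hasSum_ofReal.2 h.hasSum).summable.tsum_prod]
      refine tsum_congr fun j => tsum_congr fun k => ?_
      rw [hop, ContinuousLinearMap.comp_apply, ContinuousLinearMap.adjoint_inner_right,
        inner_self_eq_norm_sq_to_K]
      norm_cast
    | zero => simp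
    | add X Y hX hY => rw [map_add, map_add, map_add, hX, hY]
    | smul c X hX => rw [map_smul, map_smul, map_smul, hX]

theorem stine_ketbra (φ ψ : Ell2 I) (j j' : J) :
    ((stine V).toLinearMap (ketbra φ ψ)).1 j j' = ∑' k, V φ (j, k) * star (V ψ (j', k)) :=
  stineMatrix_ketbra V φ ψ j j'

end Stinespring

/-! ### Channels are determined by their values on matrix units -/

open Filter Topology

theorem Channel.map_pos {I J : Type u} (Φ : Channel I J) {X : TraceClass I}
    (hX : IsPosTraceClass X.1) : IsPosTraceClass (Φ.toLinearMap X).1 := by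
  let e := (Equiv.prodPUnit.{u} I).symm
  have h := Φ.ampliate_pos PUnit.{u + 1} ((Channel.relabel e).toLinearMap X)
    (isPosTraceClass_submatrix hX e.symm.injective)
  exact isPosTraceClass_submatrix h (f := (Equiv.prodPUnit.{u} J).symm) (Equiv.injective _)

/-- The trace-class matrix `⟨g i, g j⟩` of a square-summable family. -/
def gramClass {I : Type u} {κ : Type u} (g : I → Ell2 κ) (hg : Summable fun i => ‖g i‖ ^ 2) :
    TraceClass I := ⟨_, Submodule.subset_span (isPosTraceClass_of_norm_sq g hg)⟩

theorem trace_gramClass {I : Type u} {κ : Type u} (g : I → Ell2 κ)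
    (hg : Summable fun i => ‖g i‖ ^ 2) : trace (gramClass g hg) = ((∑' i, ‖g i‖ ^ 2 : ℝ) : ℂ) := by
  rw [Complex.ofReal_tsum]
  refine tsum_congr fun i => (inner_self_eq_norm_sq_to_K (𝕜 := ℂ) (g i)).trans ?_
  norm_cast

/-- The entries of a positive matrix are bounded by its trace, which a channel preserves. -/
theorem norm_apply_gramClass_le {I J κ : Type u} (Φ : Channel I J) (g : I → Ell2 κ)
    (hg : Summable fun i => ‖g i‖ ^ 2) (j j' : J) :
    ‖(Φ.toLinearMap (gramClass g hg)).1 j j'‖ ≤ ∑' i, ‖g i‖ ^ 2 := by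
  obtain ⟨_, h, hh, hs⟩ := (Φ.map_pos (X := gramClass g hg)
    (isPosTraceClass_of_norm_sq g hg)).exists_columns
  have h1 : ∑' i, ‖g i‖ ^ 2 = ∑' j, ‖h j‖ ^ 2 := by
    have h2 := Φ.tracePreserving (gramClass g hg)
    have h3 : Φ.toLinearMap (gramClass g hg) = gramClass h hs :=
      Subtype.ext (Matrix.ext hh)
    rw [h3, trace_gramClass, trace_gramClass] at h2
    exact_mod_cast h2.symm
  rw [h1, hh]
  have h4 := norm_inner_le_norm (𝕜 := ℂ) (h j) (h j')
  have h5 := hs.le_tsum j fun _ _ => sq_nonneg _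
  have h6 := hs.le_tsum j' fun _ _ => sq_nonneg _
  nlinarith [sq_nonneg (‖h j‖ - ‖h j'‖)]

/-- Channels are continuous for the trace norm, which allows to pass from matrices of finite support
to all matrices. A truncation error is not positive, so the cross terms between the truncation `gF`
of `g` and the rest `f = g - gF` are estimated by rescaling: with `t → 0` after `F → ∞`,
`|g⟩⟨g| = |f⟩⟨f| + |t⁻¹ f + t gF⟩⟨t⁻¹ f + t gF| - t⁻² |f⟩⟨f| + (1 - t²) |gF⟩⟨gF|`. -/
theorem Channel.apply_gramClass_eq {I J κ : Type u} {Φ Ψ : Channel I J}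
    (h : ∀ i i', Φ.toLinearMap (ketbra (ket i) (ket i')) = Ψ.toLinearMap (ketbra (ket i) (ket i')))
    (g : I → Ell2 κ) (hg : Summable fun i => ‖g i‖ ^ 2) :
    Φ.toLinearMap (gramClass g hg) = Ψ.toLinearMap (gramClass g hg) := by
  classical
  refine Subtype.ext (Matrix.ext fun j j' => sub_eq_zero.1 ?_)
  let d : TraceClass I →ₗ[ℂ] ℂ :=
    { toFun := fun X => (Φ.toLinearMap X).1 j j' - (Ψ.toLinearMap X).1 j j'
      map_add' := fun X Y => by simp; ring
      map_smul' := fun c X => by simp; ring }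
  change d (gramClass g hg) = 0
  have hd : ∀ (f : I → Ell2 κ) (hf : Summable fun i => ‖f i‖ ^ 2),
      ‖d (gramClass f hf)‖ ≤ 2 * ∑' i, ‖f i‖ ^ 2 := fun f hf => by
    refine (norm_sub_le _ _).trans ?_
    linarith [norm_apply_gramClass_le Φ f hf j j', norm_apply_gramClass_le Ψ f hf j j']
  have hd0 : ∀ i i', d (ketbra (ket i) (ket i')) = 0 := fun i i' =>
    sub_eq_zero.2 (congrArg (fun Y : TraceClass J => Y.1 j j') (h i i'))
  set N := ∑' i, ‖g i‖ ^ 2 with hN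
  have main : ∀ (t : ℝ), t ≠ 0 → ∀ F : Finset I, ‖d (gramClass g hg)‖ ≤
      (2 + 6 * (t⁻¹) ^ 2) * (N - ∑ i ∈ F, ‖g i‖ ^ 2) + 4 * t ^ 2 * N := by
    intro t ht F
    let a : I → Ell2 κ := fun i => if i ∈ F then g i else 0
    let f : I → Ell2 κ := fun i => if i ∈ F then 0 else g i
    have hFs : HasSum (fun i => if i ∈ F then ‖g i‖ ^ 2 else 0) (∑ i ∈ F, ‖g i‖ ^ 2) := by
      have : HasSum (fun i => if i ∈ F then ‖g i‖ ^ 2 else 0)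
          (∑ i ∈ F, if i ∈ F then ‖g i‖ ^ 2 else 0) :=
        hasSum_sum_of_ne_finset_zero fun i hi => if_neg hi
      rwa [Finset.sum_congr rfl fun i hi => if_pos hi] at this
    have hfs : HasSum (fun i => ‖f i‖ ^ 2) (N - ∑ i ∈ F, ‖g i‖ ^ 2) := by
      have := hg.hasSum.sub hFs
      have he : (fun i => ‖f i‖ ^ 2) = fun i => ‖g i‖ ^ 2 - if i ∈ F then ‖g i‖ ^ 2 else 0 :=
        funext fun i => by by_cases hi : i ∈ F <;> simp [f, hi]
      rwa [he]
    have has : Summable fun i => ‖a i‖ ^ 2 := by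
      refine hFs.summable.congr fun i => ?_
      by_cases hi : i ∈ F <;> simp [a, hi]
    let b : I → Ell2 κ := fun i => (t⁻¹ : ℂ) • f i + (t : ℂ) • a i
    have hb : ∀ i, ‖b i‖ ^ 2 ≤ 2 * (t⁻¹) ^ 2 * ‖f i‖ ^ 2 + 2 * t ^ 2 * ‖g i‖ ^ 2 := fun i => by
      by_cases hi : i ∈ F
      · have : ‖b i‖ = |t| * ‖g i‖ := by
          simp only [b, f, a, hi, if_true, smul_zero, zero_add, norm_smul, Complex.norm_real,
            Real.norm_eq_abs]
        rw [this, mul_pow, sq_abs]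
        nlinarith [mul_nonneg (sq_nonneg t) (sq_nonneg ‖g i‖),
          mul_nonneg (sq_nonneg t⁻¹) (sq_nonneg ‖f i‖)]
      · have : ‖b i‖ = |t⁻¹| * ‖f i‖ := by
          simp only [b, a, hi, if_false, smul_zero, add_zero, norm_smul, norm_inv,
            Complex.norm_real, Real.norm_eq_abs, abs_inv]
        rw [this, mul_pow, sq_abs]
        nlinarith [mul_nonneg (sq_nonneg t) (sq_nonneg ‖g i‖),
          mul_nonneg (sq_nonneg t⁻¹) (sq_nonneg ‖f i‖)]
    have hub := (hfs.mul_left (2 * (t⁻¹) ^ 2)).add (hg.hasSum.mul_left (2 * t ^ 2))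
    have hbs : Summable fun i => ‖b i‖ ^ 2 :=
      Summable.of_nonneg_of_le (fun _ => sq_nonneg _) hb hub.summable
    have hbt : ∑' i, ‖b i‖ ^ 2 ≤ 2 * (t⁻¹) ^ 2 * (N - ∑ i ∈ F, ‖g i‖ ^ 2) + 2 * t ^ 2 * N :=
      (hbs.tsum_le_tsum hb hub.summable).trans hub.tsum_eq.le
    have h0 : d (gramClass a has) = 0 := by
      have : gramClass a has
          = ∑ i ∈ F, ∑ i' ∈ F, inner ℂ (g i) (g i') • ketbra (ket i) (ket i') := by
        refine Subtype.ext (Matrix.ext fun k k' => ?_)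
        simp only [gramClass, a, Matrix.of_apply, Submodule.coe_sum, Submodule.coe_smul,
          Matrix.sum_apply, Matrix.smul_apply, ketbra_apply, ket_apply]
        by_cases hk : k ∈ F <;> by_cases hk' : k' ∈ F <;> simp [hk, hk']
      rw [this]
      simp [hd0]
    have hsplit : gramClass g hg = gramClass f hfs.summable + gramClass b hbs
        - ((t⁻¹ : ℂ) ^ 2) • gramClass f hfs.summable
        + (1 - (t : ℂ) ^ 2) • gramClass a has := by
      refine Subtype.ext (Matrix.ext fun k k' => ?_)
      have hg' : ∀ i, g i = f i + a i := fun i => by by_cases hi : i ∈ F <;> simp [f, a, hi]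
      have htc : (t : ℂ) ≠ 0 := by exact_mod_cast ht
      simp only [gramClass, Submodule.coe_add, Submodule.coe_sub, Submodule.coe_smul,
        Matrix.add_apply, Matrix.sub_apply, Matrix.smul_apply, Matrix.of_apply, b, hg',
        inner_add_left, inner_add_right, inner_smul_left, inner_smul_right, map_inv₀,
        Complex.conj_ofReal, smul_eq_mul]
      field_simp
      ring
    rw [hsplit, map_add, map_sub, map_add, map_smul, map_smul, h0, smul_zero, add_zero]
    have hf' := hd f hfs.summable
    rw [hfs.tsum_eq] at hf'
    refine (norm_sub_le _ _).trans ((add_le_add_left (norm_add_le _ _) _).trans ?_)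
    have hc : ‖((t⁻¹ : ℂ) ^ 2) • d (gramClass f hfs.summable)‖
        = (t⁻¹) ^ 2 * ‖d (gramClass f hfs.summable)‖ := by
      rw [norm_smul]; simp
    rw [hc]
    have := mul_le_mul_of_nonneg_left hf' (sq_nonneg t⁻¹)
    linarith [hd b hbs]
  -- First `F` exhausts `I`, then `t` tends to zero.
  have main' : ∀ t : ℝ, t ≠ 0 → ‖d (gramClass g hg)‖ ≤ 4 * t ^ 2 * N := fun t ht => by
    have h1 : Tendsto (fun F : Finset I => (2 + 6 * (t⁻¹) ^ 2) * (N - ∑ i ∈ F, ‖g i‖ ^ 2)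
        + 4 * t ^ 2 * N) atTop (𝓝 ((2 + 6 * (t⁻¹) ^ 2) * (N - N) + 4 * t ^ 2 * N)) :=
      ((hg.hasSum.const_sub N).const_mul _).add_const _
    simpa using ge_of_tendsto' h1 (main t ht)
  have h2 : Tendsto (fun t : ℝ => 4 * t ^ 2 * N) (𝓝[≠] 0) (𝓝 (4 * 0 ^ 2 * N)) :=
    (Continuous.tendsto (by fun_prop) 0).mono_left nhdsWithin_le_nhds
  have h3 := ge_of_tendsto h2 (eventually_nhdsWithin_of_forall fun t ht => main' t ht)
  exact norm_le_zero_iff.1 (by simpa using h3)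

theorem Channel.ext_of_toLinearMap {I J : Type u} {Φ Ψ : Channel I J}
    (h : ∀ X, Φ.toLinearMap X = Ψ.toLinearMap X) : Φ = Ψ := by
  cases Φ; cases Ψ; congr 1; exact LinearMap.ext h

theorem Channel.ext_of_ketbra {I J : Type u} {Φ Ψ : Channel I J}
    (h : ∀ i i', Φ.toLinearMap (ketbra (ket i) (ket i')) = Ψ.toLinearMap (ketbra (ket i) (ket i'))) :
    Φ = Ψ := by
  refine Channel.ext_of_toLinearMap fun X => ?_
  induction X using TraceClass.induction with
  | pos X hX =>
    obtain ⟨κ, g, hg, hs⟩ := hX.exists_columns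
    have : X = gramClass g hs := Subtype.ext (Matrix.ext hg)
    rw [this, Channel.apply_gramClass_eq h]
  | zero => rw [map_zero, map_zero]
  | add X Y hX hY => rw [map_add, map_add, hX, hY]
  | smul c X hX => rw [map_smul, map_smul, hX]

/-! ### Matrix units, relabelling, and tensoring with the identity -/

/-- The matrix unit `|i⟩⟨i'|`. -/
def matUnit {I : Type u} (i i' : I) : TraceClass I := ketbra (ket i) (ket i')

open Classical in
theorem matUnit_apply {I : Type u} (i i' j j' : I) :
    (matUnit i i').1 j j' = if i = j ∧ i' = j' then 1 else 0 := by
  rw [matUnit, ketbra_apply, ket_apply, ket_apply]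
  by_cases h : i = j <;> by_cases h' : i' = j' <;> simp [h, h']

open Classical in
theorem trace_matUnit {I : Type u} (i i' : I) :
    trace (matUnit i i') = if i = i' then 1 else 0 := by
  rw [matUnit, trace_ketbra, inner_ket, ket_apply]

theorem relabel_matUnit {I J : Type u} (e : I ≃ J) (i i' : I) :
    (Channel.relabel e).toLinearMap (matUnit i i') = matUnit (e i) (e i') := by
  refine Subtype.ext (Matrix.ext fun j j' => ?_)
  change (matUnit i i').1 (e.symm j) (e.symm j') = _
  rw [matUnit_apply, matUnit_apply, propext (e.eq_symm_apply (x := j) (y := i)),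
    propext (e.eq_symm_apply (x := j') (y := i'))]

open Classical in
theorem block_matUnit {I : Type u} {R : Type u} (p q : I × R) (r r' : R) :
    block r r' (matUnit p q) = if p.2 = r ∧ q.2 = r' then matUnit p.1 q.1 else 0 := by
  refine Subtype.ext (Matrix.ext fun j j' => ?_)
  change (matUnit p q).1 (j, r) (j', r') = _
  rw [matUnit_apply]
  obtain ⟨i, s⟩ := p
  obtain ⟨i', s'⟩ := q
  by_cases h : s = r <;> by_cases h' : s' = r' <;> simp [h, h', matUnit_apply]

open Classical in
theorem tensorId_matUnit_apply {I J : Type u} {R : Type u} (Φ : Channel I J) (p q : I × R)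
    (x y : J × R) : ((Φ.tensorId R).toLinearMap (matUnit p q)).1 x y =
      if p.2 = x.2 ∧ q.2 = y.2 then (Φ.toLinearMap (matUnit p.1 q.1)).1 x.1 y.1 else 0 := by
  change (Φ.toLinearMap (block x.2 y.2 (matUnit p q))).1 x.1 y.1 = _
  rw [block_matUnit]
  split_ifs <;> simp

/-! ### The Choi matrix -/

/-- The Choi matrix `⟨j|Φ(|i⟩⟨i'|)|j'⟩` of a channel, restricted to finitely many labels `i` at a
time, is the image under `Φ ⊗ id` of an unnormalized maximally entangled state. -/
theorem Channel.posSemidef_choi {I J : Type u} (Φ : Channel I J) :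
    (Matrix.of fun p q : J × I => (Φ.toLinearMap (matUnit p.2 q.2)).1 p.1 q.1).PosSemidef := by
  classical
  refine posSemidef_of_finite fun k f _ => ?_
  let g : I × Fin k → ℂ := fun p => (ket (f p.2) : Ell2 I) p.1
  have hg : Summable fun p => ‖g p‖ ^ 2 := by
    refine summable_of_hasFiniteSupport ((Set.finite_range fun r => (f r, r)).subset fun p hp => ?_)
    refine ⟨p.2, Prod.ext ?_ rfl⟩
    by_contra h
    exact hp (by simp [g, ket_apply, h])
  have hX := isPosTraceClass_of_norm_sq g hg
  let X : TraceClass (I × Fin k) := ⟨_, Submodule.subset_span hX⟩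
  have hblock : ∀ r r', block r r' X = matUnit (f r) (f r') := fun r r' => by
    refine Subtype.ext (Matrix.ext fun i i' => ?_)
    change inner ℂ (g (i, r)) (g (i', r')) = _
    rw [matUnit_apply]
    by_cases h : f r = i <;> by_cases h' : f r' = i' <;> simp [g, ket_apply, h, h']
  convert (Φ.completelyPositive k X hX).posSemidef using 1
  ext p q
  change _ = (Φ.toLinearMap (block p.2 q.2 X)).1 p.1 q.1
  rw [hblock]
  rfl

theorem Channel.exists_choi_gram {I J : Type u} (Φ : Channel I J) :
    ∃ (κ : Type u) (w : J → I → Ell2 κ), ∀ i i' j j',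
      (Φ.toLinearMap (matUnit i i')).1 j j' = inner ℂ (w j' i') (w j i) := by
  obtain ⟨κ, g, hg⟩ := exists_gram_ell2 Φ.posSemidef_choi.transpose
  exact ⟨κ, fun j i => g (j, i), fun i i' j j' => hg (j', i') (j, i)⟩

/-! ### Vectors of composite systems -/

/-- The vector of `ℓ²(J × K)` with components `x j` in `ℓ²(K)`. -/
def assemble {J K : Type u} (x : J → Ell2 K) (hx : Summable fun j => ‖x j‖ ^ 2) : Ell2 (J × K) :=
  Ell2.mk (fun p => x p.1 p.2) <| (summable_prod_of_nonneg fun _ => sq_nonneg _).2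
    ⟨fun j => (x j).summable_norm_sq, hx.congr fun j => (x j).norm_sq_eq⟩

theorem inner_assemble {J K : Type u} (x y : J → Ell2 K) (hx : Summable fun j => ‖x j‖ ^ 2)
    (hy : Summable fun j => ‖y j‖ ^ 2) :
    inner ℂ (assemble x hx) (assemble y hy) = ∑' j, inner ℂ (x j) (y j) := by
  rw [Ell2.inner_eq, (Ell2.summable_inner _ _).tsum_prod]
  exact tsum_congr fun j => (Ell2.inner_eq (x j) (y j)).symm

theorem norm_sq_assemble {J K : Type u} (x : J → Ell2 K) (hx : Summable fun j => ‖x j‖ ^ 2) :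
    ‖assemble x hx‖ ^ 2 = ∑' j, ‖x j‖ ^ 2 := by
  rw [Ell2.norm_sq_eq, (Ell2.summable_norm_sq _).tsum_prod]
  exact tsum_congr fun j => (Ell2.norm_sq_eq (x j)).symm

/-- The component `(1 ⊗ ⟨s|) x` of a vector `x`. -/
def slice {E S : Type u} (s : S) (x : Ell2 (E × S)) : Ell2 E :=
  Ell2.mk (fun e => x (e, s)) (x.summable_norm_sq.comp_injective (Prod.mk_left_injective s))

open Classical in
/-- The vector `x ⊗ |s⟩`. -/
def tensorKet {E S : Type u} (x : Ell2 E) (s : S) : Ell2 (E × S) :=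
  Ell2.mk (fun p => if s = p.2 then x p.1 else 0) <|
    ((Prod.mk_left_injective s).summable_iff fun p hp => by
      have : s ≠ p.2 := fun h => hp ⟨p.1, Prod.ext rfl h⟩
      simp [this]).1 (by simpa [Function.comp_def] using x.summable_norm_sq)

open Classical in
theorem tensorKet_apply {E S : Type u} (x : Ell2 E) (s : S) (p : E × S) :
    tensorKet x s p = if s = p.2 then x p.1 else 0 := rfl

theorem inner_tensorKet {E S : Type u} (x : Ell2 E) (s : S) (y : Ell2 (E × S)) :
    inner ℂ (tensorKet x s) y = inner ℂ x (slice s y) := by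
  rw [Ell2.inner_eq, Ell2.inner_eq, ← (Prod.mk_left_injective s).tsum_eq]
  · refine tsum_congr fun e => ?_
    simp [tensorKet_apply, slice]
  · intro p hp
    by_contra h
    have : s ≠ p.2 := fun h' => h ⟨p.1, Prod.ext rfl h'⟩
    exact hp (by simp [tensorKet_apply, this])

open Classical in
theorem inner_tensorKet_tensorKet {E S : Type u} (x y : Ell2 E) (s s' : S) :
    inner ℂ (tensorKet x s) (tensorKet y s') = if s = s' then inner ℂ x y else 0 := by
  rw [inner_tensorKet]
  by_cases h : s = s'
  · subst h
    rw [if_pos rfl]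
    congr 1
    refine lp.ext (funext fun e => ?_)
    change tensorKet y s (e, s) = _
    simp [tensorKet_apply]
  · rw [if_neg h]
    have : slice s (tensorKet y s') = 0 := by
      refine lp.ext (funext fun e => ?_)
      change tensorKet y s' (e, s) = _
      simp [tensorKet_apply, Ne.symm h]
    rw [this, inner_zero_right]

/-- The vector `x`, considered in `ℓ²(I) ⊗ ℂ`. -/
def tensorUnit {I : Type u} (x : Ell2 I) : Ell2 (I × PUnit.{u + 1}) :=
  Ell2.mk (fun p => x p.1) ((Equiv.prodPUnit I).summable_iff.2 x.summable_norm_sq)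

theorem inner_tensorUnit {I : Type u} (x y : Ell2 I) :
    inner ℂ (tensorUnit x) (tensorUnit y) = inner ℂ x y := by
  rw [Ell2.inner_eq, Ell2.inner_eq, ← (Equiv.prodPUnit.{u} I).tsum_eq]
  rfl

/-! ### No-signalling on matrix units -/

open Classical in
/-- `tr_{S'} Φ` factors through the partial trace over `S`, on matrix units. Local operations which
replace the state of `S` by a fixed one suffice to see this. -/
theorem DoesNotSignal.matUnit {S R S' R' : Type u} {Φ : Channel (S × R) (S' × R')}
    (h : DoesNotSignal Φ) (s s' t : S) (r r' : R) (y y' : R') :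
    ∑' z, (Φ.toLinearMap (matUnit (s, r) (s', r'))).1 (z, y) (z, y') =
      if s = s' then ∑' z, (Φ.toLinearMap (matUnit (t, r) (t, r'))).1 (z, y) (z, y') else 0 := by
  obtain ⟨V, hV⟩ := exists_isometry_of_orthonormal (fun s : S => (ket (t, s) : Ell2 (S × S)))
    fun i j => by rw [inner_ket, ket_apply]; simp [eq_comm]
  have hM : ((stine V).tensorId R).toLinearMap (Quantum.matUnit (s, r) (s', r'))
      = if s = s' then Quantum.matUnit (t, r) (t, r') else 0 := by
    refine Subtype.ext (Matrix.ext fun p q => ?_)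
    have hst : ((stine V).toLinearMap (Quantum.matUnit s s')).1 p.1 q.1
        = if s = s' then if t = p.1 ∧ t = q.1 then 1 else 0 else 0 := by
      simp only [Quantum.matUnit, stine_ketbra, hV, ket_apply, Prod.mk.injEq]
      rw [tsum_eq_single s]
      · by_cases h1 : t = p.1 <;> by_cases h2 : t = q.1 <;> by_cases h3 : s = s' <;>
          simp [h1, h2, h3, @eq_comm _ s' s]
      · intro k hk
        simp [hk.symm]
    rw [tensorId_matUnit_apply, hst]
    by_cases hs : s = s'
    · subst hs
      rw [if_pos rfl, if_pos rfl, matUnit_apply]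
      by_cases h1 : t = p.1 <;> by_cases h2 : t = q.1 <;> by_cases h3 : r = p.2 <;>
        by_cases h4 : r' = q.2 <;> simp [h1, h2, h3, h4, Prod.ext_iff]
    · simp [hs]
  have := congrFun (congrFun (h (stine V) (Quantum.matUnit (s, r) (s', r'))) y) y'
  change ∑' z, _ = ∑' z, ((Φ.toLinearMap (((stine V).tensorId R).toLinearMap
    (Quantum.matUnit (s, r) (s', r')))).1 (z, y) (z, y')) at this
  rw [hM] at this
  refine this.trans ?_
  split_ifs <;> simp

/-! ### Semicausal channels are semilocalizable -/

/-- The channel `(id_B ⊗ Γ) ∘ (Ψ ⊗ id_S)` for `Ψ : A → B E` and `Γ : E S → C`. -/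
def Channel.sequential {A S B C E : Type u} (Ψ : Channel A (B × E)) (Γ : Channel (E × S) C) :
    Channel (A × S) (B × C) :=
  (Channel.relabel (Equiv.prodComm C B)).comp <| (Γ.tensorId B).comp <|
    (Channel.relabel
      { toFun := fun p : (B × E) × S => ((p.1.2, p.2), p.1.1)
        invFun := fun p => ((p.2, p.1.1), p.1.2)
        left_inv := fun _ => rfl
        right_inv := fun _ => rfl }).comp (Ψ.tensorId S)

theorem Channel.sequential_apply {A S B C E : Type u} (Ψ : Channel A (B × E))
    (Γ : Channel (E × S) C) (X : TraceClass (A × S)) (Y : TraceClass (E × S)) (b b' : B) (c c' : C)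
    (h : ∀ p q, Y.1 p q = ((Ψ.tensorId S).toLinearMap X).1 ((b, p.1), p.2) ((b', q.1), q.2)) :
    ((Ψ.sequential Γ).toLinearMap X).1 (b, c) (b', c') = (Γ.toLinearMap Y).1 c c' := by
  have : Y = block b b' ((Channel.relabel
      { toFun := fun p : (B × E) × S => ((p.1.2, p.2), p.1.1)
        invFun := fun p => ((p.2, p.1.1), p.1.2)
        left_inv := fun _ => rfl
        right_inv := fun _ => rfl }).toLinearMap ((Ψ.tensorId S).toLinearMap X)) :=
    Subtype.ext (Matrix.ext h)
  rw [this]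
  rfl

open Classical in
/-- A channel `Φ : A S → B C` in which `S` does not signal to `B` is a channel `Ψ : A → B E` followed
by a channel `Γ : E S → C`. The vectors `W b (a, s)` are the components of a Stinespring isometry of
`Φ`; those for one value of `s` span the environment of a minimal Stinespring isometry of
`A → B`, and no-signalling says that they determine all the others up to an isometry. -/
theorem exists_eq_sequential {A S B C : Type u} [Nonempty S] (Φ : Channel (A × S) (B × C))
    (hΦ : ∀ a a' s s' t b b', ∑' c, (Φ.toLinearMap (matUnit (a, s) (a', s'))).1 (b, c) (b', c) =
      if s = s' then ∑' c, (Φ.toLinearMap (matUnit (a, t) (a', t))).1 (b, c) (b', c) else 0) :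
    ∃ (E : Type u) (Ψ : Channel A (B × E)) (Γ : Channel (E × S) C), Φ = Ψ.sequential Γ ∧
      ∀ a a' s b b', ∑' e, (Ψ.toLinearMap (matUnit a a')).1 (b, e) (b', e) =
        ∑' c, (Φ.toLinearMap (matUnit (a, s) (a', s))).1 (b, c) (b', c) := by
  obtain ⟨t⟩ := ‹Nonempty S›
  obtain ⟨κ, w, hw⟩ := Φ.exists_choi_gram
  have hs : ∀ p, Summable fun x => ‖w x p‖ ^ 2 := fun p =>
    summable_norm_sq_of_gram (X := (Φ.toLinearMap (matUnit p p)).1.transpose)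
      (fun i j => hw p p j i) (by simpa using summable_diag (Φ.toLinearMap (matUnit p p)).2)
  have hsb : ∀ b p, Summable fun c => ‖w (b, c) p‖ ^ 2 := fun b p =>
    (hs p).comp_injective (Prod.mk_right_injective b)
  let W : B → A × S → Ell2 (C × κ) := fun b p => assemble (fun c => w (b, c) p) (hsb b p)
  have hW : ∀ b b' p p', inner ℂ (W b' p') (W b p)
      = ∑' c, (Φ.toLinearMap (matUnit p p')).1 (b, c) (b', c) := fun b b' p p' => by
    simp only [W, inner_assemble, hw]
  have hWsum : ∀ p, Summable fun b => ‖W b p‖ ^ 2 := fun p => by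
    simp only [W, norm_sq_assemble]
    exact (hs p).prod
  obtain ⟨E, f, hf, hft⟩ := exists_total_family fun p : B × A => W p.1 (p.2, t)
  have hfn : ∀ p, ‖f p‖ = ‖W p.1 (p.2, t)‖ := fun p => by
    rw [norm_eq_sqrt_re_inner (𝕜 := ℂ), norm_eq_sqrt_re_inner (𝕜 := ℂ), hf]
  have hfs : ∀ a, Summable fun b => ‖f (b, a)‖ ^ 2 := fun a => by
    simpa only [hfn] using hWsum (a, t)
  -- The isometry `A → B E`.
  have hV₀ : ∀ a a', inner ℂ (tensorUnit (assemble (fun b => f (b, a)) (hfs a)))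
      (tensorUnit (assemble (fun b => f (b, a')) (hfs a'))) = if a = a' then (1 : ℂ) else 0 := by
    intro a a'
    have h1 := trace_matUnit (a', t) (a, t)
    rw [← Φ.tracePreserving] at h1
    rw [inner_tensorUnit, inner_assemble]
    simp only [hf, hW]
    rw [← (summable_diag (Φ.toLinearMap (matUnit (a', t) (a, t))).2).tsum_prod]
    refine h1.trans ?_
    simp [eq_comm]
  obtain ⟨V, hV⟩ := exists_isometry_of_orthonormal _ hV₀
  -- The isometry `E S → C κ`.
  obtain ⟨U, hU⟩ := exists_isometry_of_gram_eq
    (fun q : (B × A) × S => tensorKet (f q.1) q.2) (fun q => W q.1.1 (q.1.2, q.2))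
    (fun q q' => by
      simp only [inner_tensorKet_tensorKet, hf, hW]
      rw [hΦ q'.1.2 q.1.2 q'.2 q.2 t]
      simp only [eq_comm])
    (fun x hx => by
      have h1 : ∀ s, slice s x = 0 := fun s => hft _ fun p => by
        rw [← inner_tensorKet]; exact hx (p, s)
      refine lp.ext (funext fun p => ?_)
      exact congrArg (fun y : Ell2 E => y p.1) (h1 p.2))
  have hΨ : ∀ a a' b b' e e', ((stine V).toLinearMap (matUnit a a')).1 (b, e) (b', e')
      = f (b, a) e * star (f (b', a') e') := fun a a' b b' e e' => by
    rw [matUnit, stine_ketbra, hV, hV, tsum_eq_single PUnit.unit (by simp)]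
    rfl
  refine ⟨E, stine V, stine U, Channel.ext_of_ketbra fun p p' => ?_, fun a a' s b b' => ?_⟩
  · obtain ⟨a, s⟩ := p
    obtain ⟨a', s'⟩ := p'
    refine Subtype.ext (Matrix.ext fun x x' => ?_)
    obtain ⟨b, c⟩ := x
    obtain ⟨b', c'⟩ := x'
    rw [Channel.sequential_apply (Y := ketbra (tensorKet (f (b, a)) s) (tensorKet (f (b', a')) s')),
      stine_ketbra, hU ((b, a), s), hU ((b', a'), s')]
    · exact (hw _ _ _ _).trans (Ell2.inner_eq _ _)
    · intro p q
      change _ = (((stine V).tensorId S).toLinearMap (matUnit (a, s) (a', s'))).1 _ _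
      rw [tensorId_matUnit_apply, hΨ, ketbra_apply, tensorKet_apply, tensorKet_apply]
      by_cases h1 : s = p.2 <;> by_cases h2 : s' = q.2 <;> simp [h1, h2]
  · simp only [hΨ]
    rw [← Ell2.inner_eq, hf, hW, hΦ a a' t t s, if_pos rfl]

/-! ### Splitting off the last round -/

section LastRound

variable {n : ℕ} {E₀ En : Type u} {S S' : Fin (n + 1) → Type u}

/-- The input of `n + 1` rounds, with that of the last round split off. -/
def inputLast (S : Fin (n + 1) → Type u) (E₀ : Type u) :
    (E₀ × ∀ i, S i) ≃ (E₀ × ∀ i : Fin n, S i.castSucc) × S (Fin.last n) where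
  toFun p := ((p.1, (lastEquiv S p.2).1), (lastEquiv S p.2).2)
  invFun p := (p.1.1, (lastEquiv S).symm (p.1.2, p.2))
  left_inv p := by simp
  right_inv p := by simp

/-- The output of `n + 1` rounds, with that of the last round and the memory split off. -/
def outputLast (S' : Fin (n + 1) → Type u) (En : Type u) :
    ((∀ i, S' i) × En) ≃ (∀ i : Fin n, S' i.castSucc) × (S' (Fin.last n) × En) where
  toFun p := ((lastEquiv S' p.1).1, ((lastEquiv S' p.1).2, p.2))
  invFun p := ((lastEquiv S').symm (p.1, p.2.1), p.2.2)
  left_inv p := by simp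
  right_inv p := by simp

/-- A channel with `n + 1` rounds as a bipartite channel: the first `n` rounds, and the last. -/
def Channel.splitLast (Φ : Channel (E₀ × ∀ i, S i) ((∀ i, S' i) × En)) :
    Channel ((E₀ × ∀ i : Fin n, S i.castSucc) × S (Fin.last n))
      ((∀ i : Fin n, S' i.castSucc) × (S' (Fin.last n) × En)) :=
  ((Channel.relabel (outputLast S' En)).comp Φ).comp (Channel.relabel (inputLast S E₀).symm)

theorem relabel_symm_relabel {I J : Type u} (e : I ≃ J) (X : TraceClass I) :
    (Channel.relabel e.symm).toLinearMap ((Channel.relabel e).toLinearMap X) = X := by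
  refine Subtype.ext (Matrix.ext fun i j => ?_)
  change X.1 (e.symm (e i)) (e.symm (e j)) = _
  simp

/-- Appending `Γ` to a decomposition of `Ψ` decomposes `Φ`. Both sides are computed blockwise from the
same entries, whence the `rfl`. -/
theorem ChannelSequence.composeWith_snoc {E : Type u}
    (Φ : Channel (E₀ × ∀ i, S i) ((∀ i, S' i) × En))
    (Ψ : Channel (E₀ × ∀ i : Fin n, S i.castSucc) ((∀ i : Fin n, S' i.castSucc) × E))
    (Γ : Channel (E × S (Fin.last n)) (S' (Fin.last n) × En))
    (hΦ : Φ.splitLast = Ψ.sequential Γ)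
    (c : ChannelSequence (fun i => S i.castSucc) (fun i => S' i.castSucc) E₀ E)
    (hc : ∀ R, c.composeWith R = Ψ.tensorId R) (R : Type u) :
    (ChannelSequence.snoc (S := S) (S' := S') c Γ).composeWith R = Φ.tensorId R := by
  have h : Φ = ((Channel.relabel (outputLast S' En).symm).comp (Ψ.sequential Γ)).comp
      (Channel.relabel (inputLast S E₀)) := by
    rw [← hΦ]
    refine Channel.ext_of_toLinearMap fun X => ?_
    change _ = (Channel.relabel _).toLinearMap ((Channel.relabel _).toLinearMap (Φ.toLinearMap
      ((Channel.relabel _).toLinearMap ((Channel.relabel _).toLinearMap X))))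
    rw [relabel_symm_relabel, relabel_symm_relabel]
  rw [h, ChannelSequence.composeWith, hc]
  refine Channel.ext_of_toLinearMap fun X => Subtype.ext (Matrix.ext fun p q => ?_)
  rfl

/-- A single round needs no hypothesis: there are no earlier outputs, and the channel `Ψ` before it only
renames `E₀`. -/
theorem exists_channelSequence_one {E₀ En : Type u} {S S' : Fin 1 → Type u}
    (Φ : Channel (E₀ × ∀ i, S i) ((∀ i, S' i) × En)) :
    ∃ c : ChannelSequence S S' E₀ En, ∀ R, c.composeWith R = Φ.tensorId R := by
  let eA : E₀ ≃ E₀ × ∀ i : Fin 0, S i.castSucc := (Equiv.prodUnique _ _).symm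
  let eB : E₀ × (∀ i : Fin 0, S i.castSucc) ≃ (∀ i : Fin 0, S' i.castSucc) × E₀ :=
    (Equiv.prodUnique _ _).trans (Equiv.uniqueProd _ _).symm
  let Γ : Channel (E₀ × S (Fin.last 0)) (S' (Fin.last 0) × En) :=
    ((Channel.relabel (Equiv.uniqueProd _ _)).comp Φ.splitLast).comp
      (Channel.relabel (eA.prodCongr (Equiv.refl _)))
  refine ⟨.snoc .nil Γ, ChannelSequence.composeWith_snoc Φ (Channel.relabel eB) Γ ?_ .nil
    fun R => ?_⟩
  · refine Channel.ext_of_toLinearMap fun X => Subtype.ext (Matrix.ext fun p q => ?_)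
    obtain ⟨b, c⟩ := p
    obtain ⟨b', c'⟩ := q
    rw [Channel.sequential_apply (Y := (Channel.relabel
      (eA.prodCongr (Equiv.refl (S (Fin.last 0)))).symm).toLinearMap X) (h := ?_)]
    · change _ = (Φ.splitLast.toLinearMap ((Channel.relabel _).toLinearMap
        ((Channel.relabel _).toLinearMap X))).1 _ _
      have hX := relabel_symm_relabel (eA.prodCongr (Equiv.refl (S (Fin.last 0)))).symm X
      rw [Equiv.symm_symm] at hX
      rw [hX, Subsingleton.elim b default, Subsingleton.elim b' default]
      rfl
    · intro p q
      refine congrArg₂ X.1 (Prod.ext (Prod.ext rfl (Subsingleton.elim _ _)) rfl)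
        (Prod.ext (Prod.ext rfl (Subsingleton.elim _ _)) rfl)
  · refine Channel.ext_of_toLinearMap fun X => Subtype.ext (Matrix.ext fun p q => ?_)
    rfl

/-! ### No-signalling through rounds -/

/-- `NoSignalToEarlier` on matrix units: the reduced output of the rounds before `i` does not depend on
the `i`-th input, and vanishes between different `i`-th inputs. -/
def NoSignalOnUnits {n : ℕ} {S S' : Fin n → Type u} {E₀ En : Type u}
    (Φ : Channel (E₀ × ∀ j, S j) ((∀ j, S' j) × En)) (i : Fin n) : Prop :=
  ∀ (e e' : E₀) (x x' : ∀ j, S j) (t : S i) (y y' : ∀ j : {j // j < i}, S' j),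
    ∑' z, (Φ.toLinearMap (matUnit (e, x) (e', x'))).1
        ((outputSplit S' En i).symm (z, y)) ((outputSplit S' En i).symm (z, y')) =
      open Classical in
      if x i = x' i then
        ∑' z, (Φ.toLinearMap (matUnit (e, Function.update x i t) (e', Function.update x' i t))).1
          ((outputSplit S' En i).symm (z, y)) ((outputSplit S' En i).symm (z, y'))
      else 0

theorem NoSignalToEarlier.onUnits {n : ℕ} {S S' : Fin n → Type u} {E₀ En : Type u}
    {Φ : Channel (E₀ × ∀ j, S j) ((∀ j, S' j) × En)} {i : Fin n} (h : NoSignalToEarlier Φ i) :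
    NoSignalOnUnits Φ i := by
  intro e e' x x' t y y'
  have key : ∀ p p', (((Channel.relabel (outputSplit S' En i)).comp Φ).comp
      (Channel.relabel (inputSplit S E₀ i).symm)).toLinearMap (matUnit p p')
      = (Channel.relabel (outputSplit S' En i)).toLinearMap (Φ.toLinearMap
        (matUnit ((inputSplit S E₀ i).symm p) ((inputSplit S E₀ i).symm p'))) := fun p p' => by
    rw [← relabel_matUnit]; rfl
  have hin : ∀ (e : E₀) (x : ∀ j, S j), (inputSplit S E₀ i).symm (t, (inputSplit S E₀ i (e, x)).2)
      = (e, Function.update x i t) := fun e x => by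
    rw [Equiv.symm_apply_eq]
    refine Prod.ext ?_ (Prod.ext rfl (funext fun j => ?_))
    · simp [inputSplit]
    · simp [inputSplit, j.2]
  have := DoesNotSignal.matUnit h (x i) (x' i) t (inputSplit S E₀ i (e, x)).2
    (inputSplit S E₀ i (e', x')).2 y y'
  simp only [key, hin] at this
  have hx : ∀ (e : E₀) (x : ∀ j, S j), (inputSplit S E₀ i).symm (x i, (inputSplit S E₀ i (e, x)).2)
      = (e, x) := fun e x => (inputSplit S E₀ i).symm_apply_apply (e, x)
  rw [hx, hx] at this
  exact this

theorem outputSplit_symm_apply {n : ℕ} {S' : Fin n → Type u} {En : Type u} {i : Fin n}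
    (z : (∀ j : {j // ¬ j < i}, S' j) × En) (y : ∀ j : {j // j < i}, S' j) :
    (outputSplit S' En i).symm (z, y)
      = (fun j => if h : j < i then y ⟨j, h⟩ else z.1 ⟨j, h⟩, z.2) := rfl

/-- The outputs of the rounds not before `i`, with that of the last round split off. -/
def lateLast (S' : Fin (n + 1) → Type u) (En : Type u) (i : Fin n) :
    (∀ j : {j // ¬ j < i.castSucc}, S' j) × En ≃
      (∀ j : {j // ¬ j < i}, S' (Fin.castSucc j)) × (S' (Fin.last n) × En) where
  toFun z := (fun j => z.1 ⟨Fin.castSucc j.1, fun h => j.2 (Fin.castSucc_lt_castSucc_iff.1 h)⟩,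
    z.1 ⟨Fin.last n, fun h => absurd h (Fin.castSucc_lt_last i).not_gt⟩, z.2)
  invFun z := (fun j => Fin.lastCases (motive := fun j => ¬ j < i.castSucc → S' j) (fun _ => z.2.1)
    (fun j h => z.1 ⟨j, fun h' => h (Fin.castSucc_lt_castSucc_iff.2 h')⟩) j.1 j.2, z.2.2)
  left_inv z := by
    refine Prod.ext (funext fun ⟨j, hj⟩ => ?_) rfl
    induction j using Fin.lastCases <;> simp
  right_inv z := by
    refine Prod.ext (funext fun j => ?_) (Prod.ext ?_ rfl) <;> simp

/-- The outputs of the rounds before `i`, as outputs of a channel with one more round. -/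
def earlyCast (S' : Fin (n + 1) → Type u) (i : Fin n)
    (y : ∀ j : {j // j < i}, S' (Fin.castSucc j)) : ∀ j : {j // j < i.castSucc}, S' j := fun j =>
  Fin.lastCases (motive := fun j => j < i.castSucc → S' j)
    (fun h => absurd h (Fin.castSucc_lt_last i).not_gt)
    (fun j h => y ⟨j, Fin.castSucc_lt_castSucc_iff.1 h⟩) j.1 j.2

theorem outputSplit_symm_late {i : Fin n} (u : ∀ j : {j // ¬ j < i}, S' (Fin.castSucc j))
    (c : S' (Fin.last n) × En) (y : ∀ j : {j // j < i}, S' (Fin.castSucc j)) :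
    (outputSplit S' En i.castSucc).symm ((lateLast S' En i).symm (u, c), earlyCast S' i y)
      = (outputLast S' En).symm (fun j => if h : j < i then y ⟨j, h⟩ else u ⟨j, h⟩, c) := by
  rw [outputSplit_symm_apply]
  refine Prod.ext (funext fun j => ?_) rfl
  induction j using Fin.lastCases with
  | last =>
    simp only [outputLast, lastEquiv, lateLast, Equiv.coe_fn_symm_mk]
    rw [dif_neg (Fin.castSucc_lt_last i).not_gt]
    simp
  | cast j => by_cases h : j < i <;> simp [outputLast, lastEquiv, lateLast, earlyCast, h]

theorem TraceClass.summable_diag_relabel {P Z Y : Type u} (X : TraceClass P) (e : P ≃ Z × Y)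
    (y y' : Y) : Summable fun z => X.1 (e.symm (z, y)) (e.symm (z, y')) :=
  summable_diag (block y y' ((Channel.relabel e).toLinearMap X)).2

theorem Channel.splitLast_matUnit (Φ : Channel (E₀ × ∀ i, S i) ((∀ i, S' i) × En))
    (p p' : (E₀ × ∀ i : Fin n, S i.castSucc) × S (Fin.last n)) :
    Φ.splitLast.toLinearMap (matUnit p p') = (Channel.relabel (outputLast S' En)).toLinearMap
      (Φ.toLinearMap (matUnit ((inputLast S E₀).symm p) ((inputLast S E₀).symm p'))) := by
  rw [← relabel_matUnit]; rfl

/-- The outputs of the rounds not before the last one are those of the last one. -/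
def lateOfLast (S' : Fin (n + 1) → Type u) (En : Type u) :
    (∀ j : {j // ¬ j < Fin.last n}, S' j) × En ≃ S' (Fin.last n) × En where
  toFun z := (z.1 ⟨Fin.last n, lt_irrefl _⟩, z.2)
  invFun z := (fun j => Fin.lastCases (motive := fun j => ¬ j < Fin.last n → S' j) (fun _ => z.1)
    (fun j h => absurd (Fin.castSucc_lt_last j) h) j.1 j.2, z.2)
  left_inv z := by
    refine Prod.ext (funext fun ⟨j, hj⟩ => ?_) rfl
    induction j using Fin.lastCases with
    | last => simp
    | cast j => exact absurd (Fin.castSucc_lt_last j) hj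
  right_inv z := by
    refine Prod.ext ?_ rfl
    simp

/-- The outputs of the first `n` rounds, as those of the rounds before the last one. -/
def earlyOfLast (S' : Fin (n + 1) → Type u) (b : ∀ j : Fin n, S' j.castSucc) :
    ∀ j : {j // j < Fin.last n}, S' j := fun j =>
  Fin.lastCases (motive := fun j => j < Fin.last n → S' j) (fun h => absurd h (lt_irrefl _))
    (fun j _ => b j) j.1 j.2

theorem outputSplit_symm_last (b : ∀ j : Fin n, S' j.castSucc) (c : S' (Fin.last n) × En) :
    (outputSplit S' En (Fin.last n)).symm ((lateOfLast S' En).symm c, earlyOfLast S' b)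
      = (outputLast S' En).symm (b, c) := by
  rw [outputSplit_symm_apply]
  refine Prod.ext (funext fun j => ?_) rfl
  induction j using Fin.lastCases with
  | last => simp [outputLast, lastEquiv, lateOfLast]
  | cast j => simp [outputLast, lastEquiv, earlyOfLast, Fin.castSucc_lt_last]

/-- No-signalling from the last round says that the bipartite channel `Φ.splitLast` is semicausal. -/
theorem NoSignalOnUnits.splitLast {Φ : Channel (E₀ × ∀ i, S i) ((∀ i, S' i) × En)}
    (h : NoSignalOnUnits Φ (Fin.last n)) (a a' : E₀ × ∀ i : Fin n, S i.castSucc)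
    (s s' t : S (Fin.last n)) (b b' : ∀ i : Fin n, S' i.castSucc) :
    ∑' c, (Φ.splitLast.toLinearMap (matUnit (a, s) (a', s'))).1 (b, c) (b', c) =
      open Classical in
      if s = s' then ∑' c, (Φ.splitLast.toLinearMap (matUnit (a, t) (a', t))).1 (b, c) (b', c)
      else 0 := by
  have key : ∀ s s', ∑' c, (Φ.splitLast.toLinearMap (matUnit (a, s) (a', s'))).1 (b, c) (b', c)
      = ∑' z, (Φ.toLinearMap
          (matUnit (a.1, (lastEquiv S).symm (a.2, s)) (a'.1, (lastEquiv S).symm (a'.2, s')))).1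
        ((outputSplit S' En (Fin.last n)).symm (z, earlyOfLast S' b))
        ((outputSplit S' En (Fin.last n)).symm (z, earlyOfLast S' b')) := fun s s' => by
    rw [← (lateOfLast S' En).symm.tsum_eq]
    refine tsum_congr fun c => ?_
    rw [outputSplit_symm_last, outputSplit_symm_last, Channel.splitLast_matUnit]
    rfl
  have hup : ∀ (x : ∀ i : Fin n, S i.castSucc) s,
      Function.update ((lastEquiv S).symm (x, s)) (Fin.last n) t = (lastEquiv S).symm (x, t) :=
    fun x s => Fin.update_snoc_last (α := S) s x t
  have hval : ∀ (x : ∀ i : Fin n, S i.castSucc) s, (lastEquiv S).symm (x, s) (Fin.last n) = s :=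
    fun x s => Fin.snoc_last (α := S) s x
  have := h a.1 a'.1 ((lastEquiv S).symm (a.2, s)) ((lastEquiv S).symm (a'.2, s')) t
    (earlyOfLast S' b) (earlyOfLast S' b')
  rw [hup, hup, hval, hval] at this
  rw [key, key]
  exact this

/-- No-signalling is inherited by the channel `Ψ` of the first `n` rounds, because the reduced outputs
of `Ψ` are those of `Φ` for a fixed last input. -/
theorem NoSignalOnUnits.castSucc {E : Type u} {Φ : Channel (E₀ × ∀ i, S i) ((∀ i, S' i) × En)}
    {Ψ : Channel (E₀ × ∀ i : Fin n, S i.castSucc) ((∀ i : Fin n, S' i.castSucc) × E)}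
    [hS : Nonempty (S (Fin.last n))]
    (hΨ : ∀ a a' s b b', ∑' e, (Ψ.toLinearMap (matUnit a a')).1 (b, e) (b', e) =
        ∑' c, (Φ.splitLast.toLinearMap (matUnit (a, s) (a', s))).1 (b, c) (b', c)) {i : Fin n}
    (h : NoSignalOnUnits Φ i.castSucc) : NoSignalOnUnits Ψ i := by
  obtain ⟨s⟩ := hS
  have key : ∀ e e' x x' y y', ∑' z, (Ψ.toLinearMap (matUnit (e, x) (e', x'))).1
        ((outputSplit _ E i).symm (z, y)) ((outputSplit _ E i).symm (z, y'))
      = ∑' z, (Φ.toLinearMap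
          (matUnit (e, (lastEquiv S).symm (x, s)) (e', (lastEquiv S).symm (x', s)))).1
        ((outputSplit S' En i.castSucc).symm (z, earlyCast S' i y))
        ((outputSplit S' En i.castSucc).symm (z, earlyCast S' i y')) := by
    intro e e' x x' y y'
    rw [(TraceClass.summable_diag_relabel _ _ y y').tsum_prod, ← (lateLast S' En i).symm.tsum_eq,
      Summable.tsum_prod]
    · refine tsum_congr fun u => ?_
      refine (hΨ (e, x) (e', x') s (fun j => if h : j < i then y ⟨j, h⟩ else u ⟨j, h⟩)
        (fun j => if h : j < i then y' ⟨j, h⟩ else u ⟨j, h⟩)).trans ?_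
      refine tsum_congr fun c => ?_
      rw [Channel.splitLast_matUnit, outputSplit_symm_late, outputSplit_symm_late]
      rfl
    · exact (lateLast S' En i).symm.summable_iff.2 (TraceClass.summable_diag_relabel _ _ _ _)
  intro e e' x x' t y y'
  have hup : ∀ x : ∀ i : Fin n, S i.castSucc,
      Function.update ((lastEquiv S).symm (x, s)) i.castSucc t
        = (lastEquiv S).symm (Function.update x i t, s) := fun x => by
    change Function.update (Fin.snoc x s) i.castSucc t = Fin.snoc (Function.update x i t) s
    rw [Fin.snoc_update]
  have hval : ∀ x : ∀ i : Fin n, S i.castSucc, (lastEquiv S).symm (x, s) i.castSucc = x i :=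
    fun x => Fin.snoc_castSucc (α := S) s x i
  have := h e e' ((lastEquiv S).symm (x, s)) ((lastEquiv S).symm (x', s)) t
    (earlyCast S' i y) (earlyCast S' i y')
  rw [key, key]
  rw [hup, hup, hval, hval] at this
  exact this

end LastRound

/-! ### The induction over rounds -/

/-- The spectator `R` is kept in the statement because `composeWith` passes the inputs of later rounds
through it. -/
theorem exists_channelSequence {n : ℕ} : ∀ {S S' : Fin (n + 1) → Type u} {E₀ En : Type u}
    [∀ i, Nonempty (S i)] (Φ : Channel (E₀ × ∀ i, S i) ((∀ i, S' i) × En)),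
    (∀ i : Fin (n + 1), 0 < i.val → NoSignalOnUnits Φ i) →
    ∃ c : ChannelSequence S S' E₀ En, ∀ R, c.composeWith R = Φ.tensorId R := by
  induction n with
  | zero => exact fun Φ _ => exists_channelSequence_one Φ
  | succ n ih =>
    intro S S' E₀ En _ Φ hΦ
    obtain ⟨E, Ψ, Γ, hsplit, hΨ⟩ := exists_eq_sequential Φ.splitLast
      (hΦ (Fin.last (n + 1)) (by simp)).splitLast
    obtain ⟨c, hc⟩ := ih Ψ fun i hi => (hΦ i.castSucc hi).castSucc hΨ
    exact ⟨.snoc c Γ, ChannelSequence.composeWith_snoc Φ Ψ Γ hsplit c hc⟩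

end Quantum

end

theorem mainTheorem3 {n : ℕ} (hn : 0 < n) (S S' : Fin n → Type u) (E₀ En : Type u)
    [Nonempty E₀] [∀ i, Nonempty (S i)]
    (Φ : Quantum.Channel (E₀ × ∀ i, S i) ((∀ i, S' i) × En))
    (hΦ : ∀ i : Fin n, 0 < i.val → Quantum.NoSignalToEarlier Φ i) :
    ∃ c : Quantum.ChannelSequence S S' E₀ En, Φ = c.compose := by
  cases n with
  | zero => exact absurd hn (lt_irrefl 0)
  | succ n =>
    obtain ⟨c, hc⟩ := Quantum.exists_channelSequence Φ fun i hi => (hΦ i hi).onUnits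
    refine ⟨c, Quantum.Channel.ext_of_toLinearMap fun X => Subtype.ext (Matrix.ext fun p q => ?_)⟩
    rw [Quantum.ChannelSequence.compose, hc]
    rfl
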